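/- **Model.** A small-cell base station (SBS) at the centre of a disc of radius $R>0$ works in slots of length $T_p>0$. There are $N\ge 1$ contents; the $i$-th ranked one has popularity $f_i=\frac{1/i^v}{\sum_{j=1}^N 1/j^v}$, $v>0$. For a transmission at power $P\ge0$ to distance $d$ the average rate is $\mathbb E_h\big[W\log_2\big(1+\frac{P|h|^2\beta d^{-\alpha}}{\sigma^2+P_I}\big)\big]$ with $W,\beta,\alpha,\sigma^2>0$, $P_I\ge0$ and random fading $h$; $P_t(d)$ is the power for which it equals the target rate $r_0>0$ (assumed achievable at $d=R$), $P_t(0)=0$, and $E_u(d)=P_t(d)T_p$ is the unicast energy. Let $\bar E_u=\int_0^R E_u(x)\frac{2x}{R^2}\,dx$. A push costs $E_p>0$. The state at the beginning of slot $k$ consists of the stored energy $E_k\ge 0$ and the number $C_k\in\{0,\dots,N\}$ of contents already pushed to the users (always the $C_k$ most popular ones). In slot $k$ there is a request with probability $p_u\in[0,1]$, for the content of rank $i$ with probability $f_i$, from a uniformly distributed point of the disc, at distance $d$ from the SBS. Let $Q_k=E_u(d)$ if there is a request and its rank exceeds $C_k$, and $Q_k=0$ otherwise. The SBS sleeps (energy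 $U_k=0$), unicasts the requested content ($U_k=Q_k$) or pushes the content of rank $C_k+1$ ($U_k=E_p$). Then $E_{k+1}=\min\{B_{\max},E_k-U_k+A_k\}$, where the harvested energies $A_k\ge 0$ are i.i.d. with finite mean $\bar A$. At the end of the slot, with probability $p_c\in(0,1]$, a content of uniformly distributed rank in $\{1,\dots,N\}$ is replaced by a new content of rank $N$; so $C_{k+1}=C_k+\mathbf 1\{\text{push}\}-\mathbf 1\{\text{one of the contents of ranks }1,\dots,C_k\text{ is replaced}\}$. All random quantities are independent of each other and across slots. The request of slot $k$ is *blocked* if $Q_k>0$, the SBS does not unicast, and the SBS is not pushing the requested content. The blocking probability is the limit, as $K\to\infty$, of the number of blocked requests in the first $K$ slots divided by $K$. **Policy.** Put $$C=C_{\mathrm{thr,EE}}=\min\Big\{N,\Big\lfloor\Big(\frac{Np_u\bar E_u}{p_cE_p\sum_{j=1}^N 1/j^v}\Big)^{1/v}\Big\rfloor\Big\},\qquad \eta=\Big(1-\frac{p_cC}{N+p_c}\Big)p_u\Big(1-\sum_{i=1}^{C}f_i\Big),$$ and let $\tilde d$ be the largest $r\in[0,R]$ with $$\int_0^{r}E_u(x)\frac{2x}{R^2}\,dx\le\min\Big\{\bar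 E_u,\ \frac1\eta\max\Big\{0,\bar A-\frac{p_cCE_p}{N+p_c}\Big\}\Big\}$$ (with the second constraint dropped if $\eta=0$). The energy-efficient threshold-based (EETB) policy is: if $C_k<C$, push if $E_k\ge E_p$ and sleep otherwise; if $C_k\ge C$, unicast if $0<Q_k\le\min\{E_u(\tilde d),E_k\}$ and sleep otherwise. **Theorem.** Assume $\bar A\ge\frac{p_cCE_p}{N+p_c}$. Then $\tilde d$ exists and, as $B_{\max}\to\infty$, the blocking probability of the EETB policy is $$p_{\mathrm{blk,EE}}=\frac{p_cp_uC}{N+p_c}\Big(1-\sum_{i=1}^{C}f_i\Big)+\eta\,\frac{R^2-\tilde d^{\,2}}{R^2}.$$ Precisely: (i) with infinite battery ($B_{\max}=\infty$) and any initial state, the ratio of the number of blocked requests in the first $K$ slots to $K$ tends to $p_{\mathrm{blk,EE}}$ as $K\to\infty$, almost surely and in expectation; (ii) for each $\varepsilon>0$ there is $B_0$ such that for every finite $B_{\max}\ge B_0$ and every initial state with $E_0\le B_{\max}$ this ratio is, almost surely for all sufficiently large $K$, within $\varepsilon$ of $p_{\mathrm{blk,EE}}$, and so is its expectation for all sufficiently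 large $K$. -/

import Mathlib

open MeasureTheory ProbabilityTheory Filter
open scoped Topology

namespace PushEH

noncomputable section

/-- Parameters of the small cell, of its channel and of the content model. -/
structure Model where
  /-- cell radius -/
  R : ℝ
  /-- slot length -/
  Tp : ℝ
  /-- bandwidth -/
  W : ℝ
  /-- target average data rate -/
  r0 : ℝ
  /-- pathloss constant -/
  β : ℝ
  /-- pathloss exponent -/
  α : ℝ
  /-- noise power -/
  noise : ℝ
  /-- interference power -/
  interference : ℝ
  /-- law of the complex small-scale fading coefficient -/
  fading : Measure ℂ
  /-- number of contents -/
  N : ℕ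
  /-- Zipf skew parameter -/
  v : ℝ
  /-- probability of a request in a slot -/
  pu : ℝ
  /-- probability of a content replacement in a slot -/
  pc : ℝ
  /-- energy of a push -/
  Ep : ℝ

namespace Model

variable (p : Model)

/-- Average data rate at distance `d` with transmit power `P`. -/
def rate (P d : ℝ) : ℝ :=
  ∫ h, p.W * Real.logb 2
    (1 + P * ‖h‖ ^ 2 * p.β * d ^ (-p.α) / (p.noise + p.interference)) ∂p.fading

/-- The transmit power that achieves the target rate at distance `d > 0`, i.e. the nonnegative
solution `P` of `rate P d = r0` (it is unique).  At `d = 0` the value is `0`, the limit for `d → 0`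
(there the set is empty); a request has this location with probability zero. -/
def txPower (d : ℝ) : ℝ := sInf {P : ℝ | 0 ≤ P ∧ p.rate P d = p.r0}

/-- Standing assumptions on the parameters.  The last one says that the target rate can be
achieved at the cell edge with some finite power. -/
structure Valid : Prop where
  R_pos : 0 < p.R
  Tp_pos : 0 < p.Tp
  W_pos : 0 < p.W
  r0_pos : 0 < p.r0
  β_pos : 0 < p.β
  α_pos : 0 < p.α
  noise_pos : 0 < p.noise
  interference_nonneg : 0 ≤ p.interference
  fading_prob : IsProbabilityMeasure p.fading
  N_pos : 0 < p.N
  v_pos : 0 < p.v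
  pu_nonneg : 0 ≤ p.pu
  pu_le_one : p.pu ≤ 1
  pc_pos : 0 < p.pc
  pc_le_one : p.pc ≤ 1
  Ep_pos : 0 < p.Ep
  edge_reachable : ∃ P : ℝ, 0 ≤ P ∧ p.rate P p.R = p.r0

/-- Energy of a unicast to a user at distance `d`. -/
def Eu (d : ℝ) : ℝ := p.txPower d * p.Tp

/-- `∫₀^r E_u(x) 2x/R² dx`: the mean unicast energy, counting the requests from within distance `r`
of the base station only. -/
def unicastEnergy (r : ℝ) : ℝ := ∫ x in (0 : ℝ)..r, p.Eu x * (2 * x / p.R ^ 2)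

/-- Expected energy of a unicast to a uniformly located user. -/
def EuBar : ℝ := p.unicastEnergy p.R

/-- `∑_{j=1}^N 1/j^v`. -/
def zipfNorm : ℝ := ∑ j ∈ Finset.Icc 1 p.N, 1 / (j : ℝ) ^ p.v

/-- Popularity of the `i`-th ranked content, `1 ≤ i ≤ N`. -/
def f (i : ℕ) : ℝ := (1 / (i : ℝ) ^ p.v) / p.zipfNorm

/-- The energy-efficient push threshold. -/
def Cthr : ℕ :=
  min p.N ⌊((p.N * p.pu * p.EuBar) / (p.pc * p.Ep * p.zipfNorm)) ^ (1 / p.v)⌋₊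

/-- Probability that a requested content has rank larger than `C`. -/
def tail (C : ℕ) : ℝ := 1 - ∑ i ∈ Finset.Icc 1 C, p.f i

/-- `p_blk,LB(C)`. -/
def pblkLB (C : ℕ) : ℝ := p.pc * p.pu * C / (p.N + p.pc) * p.tail C

/-- Average energy needed per slot to keep `Cthr` contents pushed. -/
def pushPower : ℝ := p.pc * p.Cthr * p.Ep / (p.N + p.pc)

/-- Probability that a unicast request for an unpushed content arises. -/
def η : ℝ := (1 - p.pc * p.Cthr / (p.N + p.pc)) * p.pu * p.tail p.Cthr

/-- The radii `r` that obey
`∫₀^r E_u(x) 2x/R² dx ≤ min {Ē_u, η⁻¹ max {0, Ā - pushPower}}`, where `η⁻¹ = +∞` if `η = 0`. -/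
def admissibleRadii (Abar : ℝ) : Set ℝ :=
  {r | 0 ≤ r ∧ r ≤ p.R ∧ p.unicastEnergy r ≤ p.EuBar ∧
    p.η * p.unicastEnergy r ≤ max 0 (Abar - p.pushPower)}

/-- The unicast radius. -/
def dTilde (Abar : ℝ) : ℝ := sSup (p.admissibleRadii Abar)

/-- The closed form `p_blk,LB(Cthr) + η (R² - d̃²)/R²`. -/
def pblkEE (Abar : ℝ) : ℝ :=
  p.pblkLB p.Cthr + p.η * ((p.R ^ 2 - p.dTilde Abar ^ 2) / p.R ^ 2)

end Model

/-- The three actions of the base station. -/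
inductive Action where
  | sleep
  | unicast
  | push
  deriving DecidableEq

/-- The random data of one slot. -/
abbrev Slot : Type := ℝ × Bool × ℕ × EuclideanSpace ℝ (Fin 2) × Bool × ℕ

namespace Slot

/-- Energy harvested in the slot. -/
def harvest (s : Slot) : ℝ := s.1

/-- Is there a content request? -/
def request (s : Slot) : Bool := s.2.1

/-- Rank of the requested content. -/
def rank (s : Slot) : ℕ := s.2.2.1

/-- Location of the request; the base station is at the origin. -/
def location (s : Slot) : EuclideanSpace ℝ (Fin 2) := s.2.2.2.1

/-- Is a content replaced by a new one at the end of the slot? -/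
def replace (s : Slot) : Bool := s.2.2.2.2.1

/-- Rank of the content that is replaced. -/
def replaced (s : Slot) : ℕ := s.2.2.2.2.2

end Slot

/-- Bernoulli law. -/
def bernoulliLaw (q : ℝ) : Measure Bool :=
  ENNReal.ofReal q • Measure.dirac true + ENNReal.ofReal (1 - q) • Measure.dirac false

namespace Model

variable (p : Model)

/-- Law of the rank of the requested content. -/
def rankLaw : Measure ℕ :=
  ∑ i ∈ Finset.Icc 1 p.N, ENNReal.ofReal (p.f i) • Measure.dirac i

/-- Uniform law on the cell. -/
def locationLaw : Measure (EuclideanSpace ℝ (Fin 2)) :=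
  ProbabilityTheory.cond volume (Metric.closedBall 0 p.R)

/-- Uniform law on the ranks `1, …, N`. -/
def replacedLaw : Measure ℕ :=
  ∑ i ∈ Finset.Icc 1 p.N, ENNReal.ofReal (1 / (p.N : ℝ)) • Measure.dirac i

/-- Joint law of the data of a slot: independent components, with law `ν` of the harvested
energy. -/
def slotLaw (ν : Measure ℝ) : Measure Slot :=
  ν.prod ((bernoulliLaw p.pu).prod (p.rankLaw.prod (p.locationLaw.prod
    ((bernoulliLaw p.pc).prod p.replacedLaw))))

/-- Request state `Q`: the energy of a unicast of the requested content when `c` contents are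
pushed; zero if there is no request or the requested content has been pushed. -/
def Q (c : ℕ) (s : Slot) : ℝ :=
  if s.request = true ∧ c < s.rank then p.Eu ‖s.location‖ else 0

/-- The energy-efficient threshold-based policy with unicast radius `d`, in the state with energy
`E`, request state `Q` and `C` pushed contents. -/
def eetb (d E Q : ℝ) (C : ℕ) : Action :=
  if C < p.Cthr then
    if p.Ep ≤ E then Action.push else Action.sleep
  else
    if 0 < Q ∧ Q ≤ min (p.Eu d) E then Action.unicast else Action.sleep

/-- Energy used by an action. -/
def energyUsed (Q : ℝ) : Action → ℝ
  | Action.sleep => 0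
  | Action.unicast => Q
  | Action.push => p.Ep

/-- The action in a slot with data `s`, energy `E` and `C` pushed contents. -/
def act (d : ℝ) (x : ℝ × ℕ) (s : Slot) : Action := p.eetb d x.1 (p.Q x.2 s) x.2

/-- A request is blocked: there is a request for an unpushed content, which is neither unicast
nor the content (of rank `C + 1`) that is being pushed. -/
def Blocked (d : ℝ) (x : ℝ × ℕ) (s : Slot) : Prop :=
  0 < p.Q x.2 s ∧ p.act d x s ≠ Action.unicast ∧
    ¬ (s.rank = x.2 + 1 ∧ p.act d x s = Action.push)

/-- One slot of the dynamics of (stored energy, number of pushed contents) with battery capacity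
`B`, where `B = ⊤` is the infinite battery.  A push adds one content, and the replacement of one of
the `C` contents that were pushed before the slot removes one. -/
def step (B : EReal) (d : ℝ) (x : ℝ × ℕ) (s : Slot) : ℝ × ℕ :=
  ((min B ((x.1 - p.energyUsed (p.Q x.2 s) (p.act d x s) + s.harvest : ℝ) : EReal)).toReal,
    x.2 + (if p.act d x s = Action.push then 1 else 0)
      - (if s.replace = true ∧ s.replaced ≤ x.2 then 1 else 0))

/-- The trajectory from the initial state `x₀`, driven by the slot data `S`. -/
def traj (B : EReal) (d : ℝ) (x₀ : ℝ × ℕ) (S : ℕ → Slot) : ℕ → ℝ × ℕ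
  | 0 => x₀
  | k + 1 => p.step B d (traj B d x₀ S k) (S k)

open Classical in
/-- Ratio of the number of blocked requests in the first `K` slots to `K`. -/
def blockedRatio (B : EReal) (d : ℝ) (x₀ : ℝ × ℕ) (S : ℕ → Slot) (K : ℕ) : ℝ :=
  (((Finset.range K).filter fun k => p.Blocked d (p.traj B d x₀ S k) (S k)).card : ℝ) / K

end Model

end

end PushEH

/-! Write `q = pc / N` for `replaceProb`. While stored energy is plentiful, the number of pushed
contents settles on the two values `Cthr` and `Cthr - 1`: it drops from the upper one with
probability `q * Cthr`, and a push restores it from the lower one with probability `1 - q * (Cthr -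
1)`. The lower value has stationary weight `q * Cthr / (1 + q) = pc * Cthr / (N + pc)`. There every
request of rank above `Cthr` is blocked (rank `Cthr` is being pushed); at the upper value only those
from beyond the unicast radius are. This gives the closed form. The mean energy spent is `pushPower
+ η * unicastEnergy d`, and admissibility of the radius says that it does not exceed the mean
harvest (`demand_eq_pushPower_add`).

What has to be shown is that energy shortage and other content counts have negligible frequency,
even when demand equals harvest and the battery has no positive drift. Adding `contentValue` to the
stored energy gives a quantity whose mean change, apart from battery overflow, is mean harvest minus
`demand` plus `surplus`. The surplus is nonnegative, is bounded below when a push cannot be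
afforded, and at `Cthr` equals the unicast energy lost through shortage. The quadratic `shortfall`
below a level `b` therefore has drift at most a constant minus (depth below `b`) times surplus. At
low energy the depth is at least `Y`; after division by `Y` the average surplus there is `O(1/Y)`,
which is small once the battery is large enough to hold such a level.

The function `blockValue` solves the Poisson equation for blocking in the plentiful regime. Its
defect elsewhere is dominated by the drift of a combination of `shortfall`, `excess` and `deficit`
(`exists_test_function`). A drift criterion based on a strong law for orthogonal increments
(`eventually_avg_le_of_drift`), applied to blocking and to its negative, turns this into two-sided
pathwise bounds. -/

namespace PushEH

/-! ### Strong law for orthogonal sequences -/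

/-- A uniformly bounded orthogonal sequence satisfies the strong law of large numbers. -/
theorem ae_tendsto_avg_zero_of_orthogonal {Ω : Type*} [MeasurableSpace Ω] {μ : Measure Ω}
    [IsProbabilityMeasure μ] {D : ℕ → Ω → ℝ} {c : ℝ} (hm : ∀ k, Measurable (D k))
    (hb : ∀ k ω, |D k ω| ≤ c) (ho : ∀ j k, j < k → ∫ ω, D j ω * D k ω ∂μ = 0) :
    ∀ᵐ ω ∂μ, Tendsto (fun K : ℕ => (∑ k ∈ Finset.range K, D k ω) / K) atTop (𝓝 0) := by
  have hΩ : Nonempty Ω := nonempty_of_isProbabilityMeasure μ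
  have hc : 0 ≤ c := (abs_nonneg _).trans (hb 0 hΩ.some)
  set P : ℕ → Ω → ℝ := fun K ω => ∑ k ∈ Finset.range K, D k ω with hP
  have hPm : ∀ K, Measurable (P K) := fun K => Finset.measurable_sum _ fun k _ => hm k
  have hPb : ∀ K ω, |P K ω| ≤ K * c := by
    intro K ω
    calc |P K ω| ≤ ∑ k ∈ Finset.range K, |D k ω| := Finset.abs_sum_le_sum_abs _ _
      _ ≤ ∑ k ∈ Finset.range K, c := Finset.sum_le_sum fun k _ => hb k ω
      _ = K * c := by simp
  have hint : ∀ {F : Ω → ℝ} (a : ℝ), Measurable F → (∀ ω, |F ω| ≤ a) → Integrable F μ := by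
    intro F a hF hFa
    exact Integrable.of_bound hF.aestronglyMeasurable a (ae_of_all _ fun ω => by simpa using hFa ω)
  have hDD : ∀ j k, Integrable (fun ω => D j ω * D k ω) μ := fun j k =>
    hint (c * c) ((hm j).mul (hm k)) fun ω => by
      rw [abs_mul]; exact mul_le_mul (hb _ _) (hb _ _) (abs_nonneg _) hc
  have hPP : ∀ K, Integrable (fun ω => P K ω ^ 2) μ := fun K =>
    hint ((K * c) ^ 2) ((hPm K).pow_const 2) fun ω => by
      rw [abs_pow]; exact pow_le_pow_left₀ (abs_nonneg _) (hPb K ω) 2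
  have hsecond : ∀ K : ℕ, ∫ ω, P K ω ^ 2 ∂μ ≤ K * c ^ 2 := by
    intro K
    induction K with
    | zero => simp [hP]
    | succ K ih =>
      have h1 : ∀ ω, P (K + 1) ω ^ 2 = P K ω ^ 2 + (2 * ∑ j ∈ Finset.range K, D j ω * D K ω)
          + D K ω * D K ω := by
        intro ω
        simp only [hP, Finset.sum_range_succ, ← Finset.sum_mul]
        ring
      have hs : Integrable (fun ω => 2 * ∑ j ∈ Finset.range K, D j ω * D K ω) μ :=
        (integrable_finsetSum _ fun j _ => hDD j K).const_mul 2
      simp_rw [h1]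
      rw [integral_add (f := fun ω => P K ω ^ 2 + 2 * ∑ j ∈ Finset.range K, D j ω * D K ω)
        ((hPP K).add hs) (hDD K K), integral_add (hPP K) hs, integral_const_mul,
        integral_finsetSum _ fun j _ => hDD j K,
        Finset.sum_eq_zero fun j hj => ho j K (Finset.mem_range.1 hj)]
      have h2 : ∫ ω, D K ω * D K ω ∂μ ≤ c ^ 2 := by
        calc ∫ ω, D K ω * D K ω ∂μ ≤ ∫ _, c ^ 2 ∂μ := by
              refine integral_mono (hDD K K) (integrable_const _) fun ω => ?_
              have := hb K ω
              have h3 := abs_le.1 this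
              nlinarith
          _ = c ^ 2 := by simp
      push_cast
      linarith
  -- Along the squares the second moments of the averages are at most `c ^ 2 / n ^ 2`, which is
  -- summable; so the squared averages are almost surely summable and tend to zero.
  have hsub : ∀ᵐ ω ∂μ, Tendsto (fun n : ℕ => (P (n ^ 2) ω / (n : ℝ) ^ 2) ^ 2) atTop (𝓝 0) := by
    have hmeas : ∀ n : ℕ, Measurable fun ω =>
        ENNReal.ofReal ((P (n ^ 2) ω / (n : ℝ) ^ 2) ^ 2) := fun n =>
      (((hPm _).div_const _).pow_const 2).ennreal_ofReal
    have hle : ∀ n : ℕ, ∫⁻ ω, ENNReal.ofReal ((P (n ^ 2) ω / (n : ℝ) ^ 2) ^ 2) ∂μ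
        ≤ ENNReal.ofReal (c ^ 2 * (1 / (n : ℝ) ^ 2)) := by
      intro n
      have he : ∀ ω, (P (n ^ 2) ω / (n : ℝ) ^ 2) ^ 2 = (1 / (n : ℝ) ^ 4) * P (n ^ 2) ω ^ 2 := by
        intro ω; ring
      simp_rw [he]
      rw [← ofReal_integral_eq_lintegral_ofReal ((hPP _).const_mul _)
        (ae_of_all _ fun ω => by positivity), integral_const_mul]
      apply ENNReal.ofReal_le_ofReal
      have := hsecond (n ^ 2)
      rcases Nat.eq_zero_or_pos n with rfl | hn
      · simp
      · have hn' : (0 : ℝ) < n := by exact_mod_cast hn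
        calc 1 / (n : ℝ) ^ 4 * ∫ ω, P (n ^ 2) ω ^ 2 ∂μ
            ≤ 1 / (n : ℝ) ^ 4 * (((n ^ 2 : ℕ) : ℝ) * c ^ 2) := by gcongr
          _ = c ^ 2 * (1 / (n : ℝ) ^ 2) := by push_cast; field_simp
    have hsum : ∑' n : ℕ, ∫⁻ ω, ENNReal.ofReal ((P (n ^ 2) ω / (n : ℝ) ^ 2) ^ 2) ∂μ ≠ ⊤ := by
      refine ne_top_of_le_ne_top ?_ (ENNReal.tsum_le_tsum hle)
      have : Summable fun n : ℕ => c ^ 2 * (1 / (n : ℝ) ^ 2) :=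
        (Real.summable_one_div_nat_pow.2 (by norm_num)).mul_left _
      exact this.tsum_ofReal_ne_top
    rw [← lintegral_tsum fun n => (hmeas n).aemeasurable] at hsum
    filter_upwards [ae_lt_top (Measurable.tsum hmeas) hsum] with ω hω
    have h1 := ENNReal.tendsto_atTop_zero_of_tsum_ne_top hω.ne
    have h2 := (ENNReal.tendsto_toReal ENNReal.zero_ne_top).comp h1
    refine (h2.congr fun n => ?_)
    simp only [Function.comp]
    rw [ENNReal.toReal_ofReal (by positivity)]
  filter_upwards [hsub] with ω hω
  have h1 : Tendsto (fun n : ℕ => |P (n ^ 2) ω / (n : ℝ) ^ 2|) atTop (𝓝 0) := by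
    have := (Real.continuous_sqrt.tendsto 0).comp hω
    simpa [Function.comp_def, Real.sqrt_sq_eq_abs] using this
  have h2 : Tendsto (fun n : ℕ => |P (n ^ 2) ω / (n : ℝ) ^ 2| + 2 * c / n) atTop (𝓝 0) := by
    simpa using h1.add (tendsto_const_div_atTop_nhds_zero_nat (2 * c))
  have h3 : Tendsto Nat.sqrt atTop atTop :=
    tendsto_atTop.2 fun n => eventually_atTop.2 ⟨n * n, fun K hK => Nat.le_sqrt.2 hK⟩
  rw [tendsto_zero_iff_abs_tendsto_zero]
  refine squeeze_zero' (Eventually.of_forall fun _ => abs_nonneg _) ?_ (h2.comp h3)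
  filter_upwards [eventually_ge_atTop 1] with K hK
  simp only [Function.comp]
  set n := Nat.sqrt K with hn
  have hn1 : 1 ≤ n := Nat.le_sqrt.2 (by simpa using hK)
  have hnK : n ^ 2 ≤ K := by rw [sq]; exact Nat.sqrt_le K
  have hKn : K ≤ n ^ 2 + 2 * n := by
    have := Nat.sqrt_le_add K
    rw [sq, hn]; omega
  -- Consecutive squares differ by `2 * n + 1`, so the partial sum moves by at most `2 * n * c` in
  -- between, which is negligible against `n ^ 2`.
  have hd : |P K ω - P (n ^ 2) ω| ≤ 2 * n * c := by
    have : P K ω - P (n ^ 2) ω = ∑ k ∈ Finset.Ico (n ^ 2) K, D k ω := by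
      rw [Finset.sum_Ico_eq_sub _ hnK]
    rw [this]
    calc |∑ k ∈ Finset.Ico (n ^ 2) K, D k ω| ≤ ∑ k ∈ Finset.Ico (n ^ 2) K, |D k ω| :=
          Finset.abs_sum_le_sum_abs _ _
      _ ≤ ∑ k ∈ Finset.Ico (n ^ 2) K, c := Finset.sum_le_sum fun k _ => hb k ω
      _ = ((K - n ^ 2 : ℕ) : ℝ) * c := by simp
      _ ≤ 2 * n * c := by
          gcongr
          have : K - n ^ 2 ≤ 2 * n := by omega
          exact_mod_cast this
  have hn0 : (0 : ℝ) < n := by exact_mod_cast hn1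
  have hKn' : (n : ℝ) ^ 2 ≤ K := by exact_mod_cast hnK
  have hK0 : (0 : ℝ) < K := by exact_mod_cast hK
  have habs : |P K ω| ≤ |P (n ^ 2) ω| + 2 * n * c := by
    have := abs_sub_abs_le_abs_sub (P K ω) (P (n ^ 2) ω)
    linarith
  calc |P K ω / K| = |P K ω| / K := by rw [abs_div, abs_of_pos hK0]
    _ ≤ (|P (n ^ 2) ω| + 2 * n * c) / (n : ℝ) ^ 2 :=
        div_le_div₀ (by positivity) habs (by positivity) hKn'
    _ = |P (n ^ 2) ω / (n : ℝ) ^ 2| + 2 * c / n := by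
        rw [abs_div, abs_of_pos (by positivity : (0 : ℝ) < (n : ℝ) ^ 2)]
        field_simp

/-! ### Recursions driven by i.i.d. data and the drift criterion -/

section Lyapunov

variable {X Y Ω : Type*} [MeasurableSpace X] [MeasurableSpace Y]
  {S : ℕ → Ω → Y} {st : X → Y → X} {Z : ℕ → Ω → X}

/-- The state of a recursion driven by `S` is a function of the past of `S`. -/
theorem measurable_past (hst : Measurable (Function.uncurry st)) (x₀ : X)
    (hZ0 : ∀ ω, Z 0 ω = x₀) (hZ : ∀ k ω, Z (k + 1) ω = st (Z k ω) (S k ω)) (k : ℕ) :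
    Measurable[⨆ i ∈ Set.Iio k, MeasurableSpace.comap (S i) inferInstance] (Z k) := by
  induction k with
  | zero =>
    have : Z 0 = fun _ => x₀ := funext hZ0
    rw [this]
    exact measurable_const
  | succ k ih =>
    have : Z (k + 1) = fun ω => Function.uncurry st (Z k ω, S k ω) := funext (hZ k)
    rw [this]
    refine hst.comp (Measurable.prodMk (ih.mono ?_ le_rfl) ?_)
    · exact biSup_mono fun i hi => lt_trans (Set.mem_Iio.1 hi) (Nat.lt_succ_self k)
    · refine (comap_measurable (S k)).mono ?_ le_rfl
      exact le_biSup (fun i => MeasurableSpace.comap (S i) inferInstance)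
        (Set.mem_Iio.2 (Nat.lt_succ_self k))

variable [MeasurableSpace Ω] {μ : Measure Ω} [IsProbabilityMeasure μ] {ρ : Measure Y}
  [IsProbabilityMeasure ρ]

/-- Law of large numbers for the increments of a recursion driven by an i.i.d. sequence. -/
theorem ae_tendsto_avg_sub_condMean (hS : ∀ k, Measurable (S k)) (hlaw : ∀ k, μ.map (S k) = ρ)
    (hind : iIndepFun S μ) (hst : Measurable (Function.uncurry st)) (x₀ : X)
    (hZ0 : ∀ ω, Z 0 ω = x₀) (hZ : ∀ k ω, Z (k + 1) ω = st (Z k ω) (S k ω))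
    {φ : X → Y → ℝ} (hφ : Measurable (Function.uncurry φ)) {c : ℝ} (hc : ∀ x y, |φ x y| ≤ c) :
    ∀ᵐ ω ∂μ, Tendsto (fun K : ℕ => (∑ k ∈ Finset.range K,
      (φ (Z k ω) (S k ω) - ∫ y, φ (Z k ω) y ∂ρ)) / K) atTop (𝓝 0) := by
  set F : ℕ → MeasurableSpace Ω :=
    fun k => ⨆ i ∈ Set.Iio k, MeasurableSpace.comap (S i) inferInstance with hF
  have hFle : ∀ k, F k ≤ ‹MeasurableSpace Ω› := fun k => iSup₂_le fun i _ => (hS i).comap_le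
  have hZF : ∀ k, Measurable[F k] (Z k) := measurable_past hst x₀ hZ0 hZ
  have hmean : Measurable fun x => ∫ y, φ x y ∂ρ :=
    (hφ.stronglyMeasurable.integral_prod_right (ν := ρ)).measurable
  have hmeanb : ∀ x, |∫ y, φ x y ∂ρ| ≤ c := by
    intro x
    have := norm_integral_le_of_norm_le_const (μ := ρ) (f := φ x) (C := c)
      (ae_of_all _ fun y => by simpa using hc x y)
    simpa using this
  have hψ : Measurable fun z : X × Y => φ z.1 z.2 - ∫ y, φ z.1 y ∂ρ :=
    hφ.sub (hmean.comp measurable_fst)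
  have hφi : ∀ x, Integrable (φ x) ρ := fun x =>
    Integrable.of_bound (hφ.comp (measurable_const.prodMk measurable_id)).aestronglyMeasurable c
      (ae_of_all _ fun y => by simpa using hc x y)
  have hb : ∀ k ω, |φ (Z k ω) (S k ω) - ∫ y, φ (Z k ω) y ∂ρ| ≤ 2 * c := fun k ω => by
    have h1 := abs_sub (φ (Z k ω) (S k ω)) (∫ y, φ (Z k ω) y ∂ρ)
    have h2 := hc (Z k ω) (S k ω)
    have h3 := hmeanb (Z k ω)
    linarith
  refine ae_tendsto_avg_zero_of_orthogonal (c := 2 * c)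
    (D := fun k ω => φ (Z k ω) (S k ω) - ∫ y, φ (Z k ω) y ∂ρ) (fun k => ?_) hb ?_
  · exact hψ.comp (((hZF k).mono (hFle k) le_rfl).prodMk (hS k))
  intro j k hjk
  have hDj : Measurable[F k] fun ω => φ (Z j ω) (S j ω) - ∫ y, φ (Z j ω) y ∂ρ := by
    refine hψ.comp (Measurable.prodMk ((hZF j).mono ?_ le_rfl) ((comap_measurable (S j)).mono ?_ le_rfl))
    · exact biSup_mono fun i hi => lt_trans (Set.mem_Iio.1 hi) hjk
    · exact le_biSup (fun i => MeasurableSpace.comap (S i) inferInstance) (Set.mem_Iio.2 hjk)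
  have hpair : Measurable[F k] fun ω => (φ (Z j ω) (S j ω) - ∫ y, φ (Z j ω) y ∂ρ, Z k ω) :=
    Measurable.prodMk hDj (hZF k)
  -- The earlier increment and the state `Z k` depend only on the data before `k`, hence are
  -- independent of `S k`. By Fubini the later increment can be averaged over `S k` first, and that
  -- average is zero.
  have hindep : IndepFun (fun ω => (φ (Z j ω) (S j ω) - ∫ y, φ (Z j ω) y ∂ρ, Z k ω)) (S k) μ := by
    have h1 : Indep (F k) (⨆ i ∈ ({k} : Set ℕ), MeasurableSpace.comap (S i) inferInstance) μ :=
      indep_iSup_of_disjoint (fun i => (hS i).comap_le) hind.iIndep (by simp)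
    rw [iSup_singleton] at h1
    exact indep_of_indep_of_le_left h1 hpair.comap_le
  have hmap := (indepFun_iff_map_prod_eq_prod_map_map (hpair.mono (hFle k) le_rfl).aemeasurable
    (hS k).aemeasurable).1 hindep
  rw [hlaw k] at hmap
  set κ := μ.map fun ω => (φ (Z j ω) (S j ω) - ∫ y, φ (Z j ω) y ∂ρ, Z k ω) with hκ
  have hκp : IsProbabilityMeasure κ :=
    Measure.isProbabilityMeasure_map (hpair.mono (hFle k) le_rfl).aemeasurable
  have hH : Measurable fun w : (ℝ × X) × Y => w.1.1 * (φ w.1.2 w.2 - ∫ y, φ w.1.2 y ∂ρ) :=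
    (measurable_fst.comp measurable_fst).mul
      (hψ.comp ((measurable_snd.comp measurable_fst).prodMk measurable_snd))
  have hall : Measurable fun ω => ((φ (Z j ω) (S j ω) - ∫ y, φ (Z j ω) y ∂ρ, Z k ω), S k ω) :=
    (hpair.mono (hFle k) le_rfl).prodMk (hS k)
  have hswap : ∫ ω, (φ (Z j ω) (S j ω) - ∫ y, φ (Z j ω) y ∂ρ) *
      (φ (Z k ω) (S k ω) - ∫ y, φ (Z k ω) y ∂ρ) ∂μ
      = ∫ w, w.1.1 * (φ w.1.2 w.2 - ∫ y, φ w.1.2 y ∂ρ) ∂(κ.prod ρ) := by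
    rw [← hmap, integral_map hall.aemeasurable hH.aestronglyMeasurable]
  rw [hswap]
  have hHi : Integrable (fun w : (ℝ × X) × Y => w.1.1 * (φ w.1.2 w.2 - ∫ y, φ w.1.2 y ∂ρ))
      (κ.prod ρ) := by
    rw [← hmap, integrable_map_measure hH.aestronglyMeasurable hall.aemeasurable]
    refine Integrable.of_bound (hH.comp hall).aestronglyMeasurable (2 * c * (2 * c))
      (ae_of_all _ fun ω => ?_)
    simp only [Function.comp, Real.norm_eq_abs, abs_mul]
    exact mul_le_mul (hb j ω) (hb k ω) (abs_nonneg _) ((abs_nonneg _).trans (hb j ω))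
  rw [integral_prod _ hHi]
  refine integral_eq_zero_of_ae (ae_of_all _ fun w => ?_)
  simp only [Pi.zero_apply]
  rw [integral_const_mul, integral_sub (hφi _) (integrable_const _)]
  simp

/-- If the one-step mean of `r + Φ ∘ st` is at most `Φ + c`, then the long-run average of `r` is at
most `c`. -/
theorem eventually_avg_le_of_drift (hS : ∀ k, Measurable (S k)) (hlaw : ∀ k, μ.map (S k) = ρ)
    (hind : iIndepFun S μ) (hst : Measurable (Function.uncurry st)) (x₀ : X)
    (hZ0 : ∀ ω, Z 0 ω = x₀) (hZ : ∀ k ω, Z (k + 1) ω = st (Z k ω) (S k ω))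
    {r : X → Y → ℝ} (hr : Measurable (Function.uncurry r)) {a : ℝ} (ha : ∀ x y, |r x y| ≤ a)
    {Φ : X → ℝ} (hΦ : Measurable Φ) {a' : ℝ} (ha' : ∀ x, |Φ x| ≤ a')
    {A : Set X} (hA : ∀ᵐ ω ∂μ, ∀ k, Z k ω ∈ A) {c : ℝ}
    (hdrift : ∀ x ∈ A, ∫ y, (r x y + Φ (st x y)) ∂ρ ≤ Φ x + c) {δ : ℝ} (hδ : 0 < δ) :
    ∀ᵐ ω ∂μ, ∀ᶠ K : ℕ in atTop, (∑ k ∈ Finset.range K, r (Z k ω) (S k ω)) / K ≤ c + δ := by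
  have hlln := ae_tendsto_avg_sub_condMean hS hlaw hind hst x₀ hZ0 hZ
    (φ := fun x y => r x y + Φ (st x y)) (hr.add (hΦ.comp hst)) (c := a + a')
    (fun x y => (abs_add_le _ _).trans (add_le_add (ha _ _) (ha' _)))
  filter_upwards [hlln, hA] with ω h1 h2
  have h3 : Tendsto (fun K : ℕ => 2 * a' / (K : ℝ)) atTop (𝓝 0) :=
    tendsto_const_div_atTop_nhds_zero_nat _
  filter_upwards [h1.eventually_lt_const (half_pos hδ), h3.eventually_lt_const (half_pos hδ),
    eventually_ge_atTop 1] with K hK1 hK2 hK3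
  have hK0 : (0 : ℝ) < K := by exact_mod_cast hK3
  rw [div_lt_iff₀ hK0] at hK1 hK2
  rw [div_le_iff₀ hK0]
  -- The potential telescopes to at most `2 * a'`, which disappears after division by `K`; the
  -- conditional means are controlled by the drift.
  have htel : ∑ k ∈ Finset.range K, (Φ (Z (k + 1) ω) - Φ (Z k ω)) = Φ (Z K ω) - Φ (Z 0 ω) :=
    Finset.sum_range_sub (fun k => Φ (Z k ω)) K
  have hsum : ∑ k ∈ Finset.range K, (r (Z k ω) (S k ω) + (Φ (Z (k + 1) ω) - Φ (Z k ω)) - c)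
      ≤ ∑ k ∈ Finset.range K, (r (Z k ω) (S k ω) + Φ (st (Z k ω) (S k ω))
        - ∫ y, (r (Z k ω) y + Φ (st (Z k ω) y)) ∂ρ) := by
    refine Finset.sum_le_sum fun k _ => ?_
    have := hdrift _ (h2 k)
    rw [hZ]
    linarith
  rw [Finset.sum_sub_distrib, Finset.sum_add_distrib, htel] at hsum
  simp only [Finset.sum_const, Finset.card_range, nsmul_eq_mul] at hsum
  have := abs_le.1 (ha' (Z K ω))
  have := abs_le.1 (ha' (Z 0 ω))
  nlinarith

end Lyapunov

/-! ### Transmit power, unicast energy and the unicast radius -/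

namespace Model

variable {p : Model}

/-- Power and distance enter only through the received strength `P * d ^ (-α)`. Hence the required
power is a constant times `d ^ α`. -/
theorem rate_eq_rate_one (d P : ℝ) : p.rate P d = p.rate (P * d ^ (-p.α)) 1 := by
  unfold rate
  refine integral_congr_ae (ae_of_all _ fun h => ?_)
  simp only [Real.one_rpow]
  ring_nf

theorem Valid.rate_zero (P : ℝ) (hp : p.Valid) : p.rate P 0 = 0 := by
  simp [rate, Real.zero_rpow (neg_ne_zero.2 hp.α_pos.ne')]

/-- The target rate is achieved at unit distance by exactly one power. -/
theorem Valid.exists_unitPower (hp : p.Valid) :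
    ∃ t : ℝ, 0 < t ∧ {P : ℝ | 0 ≤ P ∧ p.rate P 1 = p.r0} = {t} := by
  obtain ⟨P, hP0, hP⟩ := hp.edge_reachable
  rw [rate_eq_rate_one] at hP
  set t := P * p.R ^ (-p.α) with ht
  have ht0 : 0 ≤ t := mul_nonneg hP0 (Real.rpow_nonneg hp.R_pos.le _)
  have hr0 := hp.r0_pos
  have hpos : ∀ s : ℝ, 0 ≤ s → p.rate s 1 = p.r0 → 0 < s := by
    intro s hs h
    refine lt_of_le_of_ne hs fun h0 => ?_
    rw [← h0] at h
    simp [rate] at h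
    linarith
  have huniq : ∀ s u : ℝ, 0 ≤ s → s < u → p.rate s 1 = p.r0 → p.rate u 1 = p.r0 → False := by
    intro s u hs hsu h1 h2
    have hn : 0 < p.noise + p.interference := by
      linarith [hp.noise_pos, hp.interference_nonneg]
    -- A non-integrable rate has the default integral `0`, which differs from `r0`; attaining the
    -- target therefore implies integrability.
    have hint : ∀ w : ℝ, p.rate w 1 = p.r0 → Integrable (fun h : ℂ => p.W * Real.logb 2
        (1 + w * ‖h‖ ^ 2 * p.β * 1 ^ (-p.α) / (p.noise + p.interference))) p.fading := by
      intro w hw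
      by_contra hni
      have : p.rate w 1 = 0 := integral_undef hni
      linarith
    have hβ := hp.β_pos
    have hnn : ∀ w : ℝ, 0 ≤ w → ∀ h : ℂ,
        0 ≤ w * ‖h‖ ^ 2 * p.β * 1 ^ (-p.α) / (p.noise + p.interference) := by
      intro w hw h
      rw [Real.one_rpow]
      positivity
    have hmono : ∀ h : ℂ, p.W * Real.logb 2
        (1 + s * ‖h‖ ^ 2 * p.β * 1 ^ (-p.α) / (p.noise + p.interference)) ≤ p.W * Real.logb 2
        (1 + u * ‖h‖ ^ 2 * p.β * 1 ^ (-p.α) / (p.noise + p.interference)) := by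
      intro h
      refine mul_le_mul_of_nonneg_left ?_ hp.W_pos.le
      refine Real.logb_le_logb_of_le (by norm_num) (by linarith [hnn s hs h]) ?_
      rw [Real.one_rpow]
      gcongr
    have heq : (fun h : ℂ => p.W * Real.logb 2
        (1 + s * ‖h‖ ^ 2 * p.β * 1 ^ (-p.α) / (p.noise + p.interference))) =ᵐ[p.fading]
        fun h : ℂ => p.W * Real.logb 2
        (1 + u * ‖h‖ ^ 2 * p.β * 1 ^ (-p.α) / (p.noise + p.interference)) :=
      (integral_eq_iff_of_ae_le (hint s h1) (hint u h2) (ae_of_all _ hmono)).1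
        (by simpa [rate] using h1.trans h2.symm)
    -- The integrand is monotone in the power, so equal integrals force equality almost everywhere.
    -- With `s < u` this makes the fading vanish almost surely, and then the rate is zero.
    have hzero : p.rate u 1 = 0 := by
      refine integral_eq_zero_of_ae ?_
      filter_upwards [heq] with h hh
      have h3 := mul_left_cancel₀ hp.W_pos.ne' hh
      have h4 : 1 + s * ‖h‖ ^ 2 * p.β * 1 ^ (-p.α) / (p.noise + p.interference)
          = 1 + u * ‖h‖ ^ 2 * p.β * 1 ^ (-p.α) / (p.noise + p.interference) :=
        Real.logb_injOn_pos (by norm_num) (Set.mem_Ioi.2 (by linarith [hnn s hs h]))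
          (Set.mem_Ioi.2 (by linarith [hnn u (hs.trans hsu.le) h])) h3
      have h5 : ‖h‖ ^ 2 = 0 := by
        rw [Real.one_rpow] at h4
        field_simp at h4
        by_contra hne
        have : 0 < ‖h‖ ^ 2 := lt_of_le_of_ne (sq_nonneg _) (Ne.symm hne)
        have h6 := mul_pos (mul_pos this hβ) (sub_pos.2 hsu)
        nlinarith
      simp [h5]
    linarith
  refine ⟨t, hpos t ht0 hP, Set.eq_singleton_iff_unique_mem.2 ⟨⟨ht0, hP⟩, ?_⟩⟩
  rintro s ⟨hs0, hs⟩
  rcases lt_trichotomy s t with h | h | h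
  · exact (huniq s t hs0 h hs hP).elim
  · exact h
  · exact (huniq t s ht0 h hP hs).elim

/-- The unicast energy is a multiple of `d ^ α`. -/
theorem Valid.exists_Eu_eq (hp : p.Valid) :
    ∃ κ : ℝ, 0 < κ ∧ ∀ d : ℝ, 0 ≤ d → p.Eu d = κ * d ^ p.α := by
  obtain ⟨t, ht, hset⟩ := hp.exists_unitPower
  refine ⟨t * p.Tp, mul_pos ht hp.Tp_pos, fun d hd => ?_⟩
  rcases hd.eq_or_lt with rfl | hd
  · have : {P : ℝ | 0 ≤ P ∧ p.rate P 0 = p.r0} = ∅ := by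
      ext P
      simp [hp.rate_zero P, hp.r0_pos.ne]
    simp [Eu, txPower, this, Real.zero_rpow hp.α_pos.ne']
  · have hdα := Real.rpow_pos_of_pos hd (-p.α)
    have : {P : ℝ | 0 ≤ P ∧ p.rate P d = p.r0} = {t * d ^ p.α} := by
      ext P
      have h1 : P * d ^ (-p.α) ∈ {P : ℝ | 0 ≤ P ∧ p.rate P 1 = p.r0} ↔ P * d ^ (-p.α) = t := by
        rw [hset, Set.mem_singleton_iff]
      rw [Set.mem_ofPred_eq, mul_nonneg_iff_of_pos_right hdα, ← rate_eq_rate_one] at h1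
      rw [Set.mem_ofPred_eq, h1, Set.mem_singleton_iff, Real.rpow_neg hd.le, ← div_eq_mul_inv,
        div_eq_iff (Real.rpow_pos_of_pos hd _).ne']
    simp only [Eu, txPower, this, csInf_singleton]
    ring

theorem Valid.Eu_zero (hp : p.Valid) : p.Eu 0 = 0 := by
  obtain ⟨κ, -, h⟩ := hp.exists_Eu_eq
  simp [h 0 le_rfl, Real.zero_rpow hp.α_pos.ne']

theorem Valid.Eu_lt_Eu (hp : p.Valid) {x y : ℝ} (hx : 0 ≤ x) (hy : 0 ≤ y) :
    p.Eu x < p.Eu y ↔ x < y := by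
  obtain ⟨κ, hκ, h⟩ := hp.exists_Eu_eq
  rw [h x hx, h y hy, mul_lt_mul_iff_right₀ hκ, Real.rpow_lt_rpow_iff hx hy hp.α_pos]

theorem Valid.Eu_le_Eu (hp : p.Valid) {x y : ℝ} (hx : 0 ≤ x) (hy : 0 ≤ y) :
    p.Eu x ≤ p.Eu y ↔ x ≤ y := by
  rw [← not_lt, hp.Eu_lt_Eu hy hx, not_lt]

theorem Valid.Eu_pos (hp : p.Valid) {x : ℝ} (hx : 0 ≤ x) : 0 < p.Eu x ↔ 0 < x := by
  simpa [hp.Eu_zero] using hp.Eu_lt_Eu le_rfl hx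

theorem Valid.Eu_nonneg (hp : p.Valid) {x : ℝ} (hx : 0 ≤ x) : 0 ≤ p.Eu x := by
  rw [← hp.Eu_zero, hp.Eu_le_Eu le_rfl hx]
  exact hx

theorem Valid.measurable_Eu_norm (hp : p.Valid) :
    Measurable fun z : EuclideanSpace ℝ (Fin 2) => p.Eu ‖z‖ := by
  obtain ⟨κ, -, h⟩ := hp.exists_Eu_eq
  simp_rw [fun z : EuclideanSpace ℝ (Fin 2) => h ‖z‖ (norm_nonneg z)]
  exact (measurable_norm.pow_const _).const_mul _

theorem Valid.continuousOn_Eu (hp : p.Valid) : ContinuousOn p.Eu (Set.Ici 0) := by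
  obtain ⟨κ, -, h⟩ := hp.exists_Eu_eq
  refine ContinuousOn.congr (f := fun d => κ * d ^ p.α) ?_ fun d hd => h d hd
  exact continuousOn_const.mul (continuousOn_id.rpow_const fun _ _ => Or.inr hp.α_pos.le)

theorem Valid.unicastEnergy_nonneg (hp : p.Valid) {r : ℝ} (hr : 0 ≤ r) : 0 ≤ p.unicastEnergy r := by
  refine intervalIntegral.integral_nonneg hr fun x hx => ?_
  have := hp.Eu_nonneg hx.1
  have := hx.1
  positivity

theorem Valid.continuousOn_unicastEnergy (hp : p.Valid) :
    ContinuousOn p.unicastEnergy (Set.Icc 0 p.R) := by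
  have h0 := hp.R_pos.le
  have hc : ContinuousOn (fun x => p.Eu x * (2 * x / p.R ^ 2)) (Set.Icc 0 p.R) :=
    (hp.continuousOn_Eu.mono Set.Icc_subset_Ici_self).mul (by fun_prop)
  have := intervalIntegral.continuousOn_primitive_interval (μ := volume) (a := 0) (b := p.R)
    (f := fun x => p.Eu x * (2 * x / p.R ^ 2)) (by
      rw [Set.uIcc_of_le h0]; exact hc.integrableOn_Icc)
  rwa [Set.uIcc_of_le h0] at this

/-- The unicast radius is the largest admissible one. -/
theorem Valid.isGreatest_dTilde (hp : p.Valid) (Abar : ℝ) :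
    IsGreatest (p.admissibleRadii Abar) (p.dTilde Abar) := by
  have h0 := hp.R_pos.le
  -- The constraints are closed conditions on a continuous function of the radius, so the supremum
  -- of the bounded nonempty set is attained.
  have hcl : IsClosed (p.admissibleRadii Abar) := by
    have : p.admissibleRadii Abar = Set.Icc 0 p.R ∩
        (fun r => (p.unicastEnergy r, p.η * p.unicastEnergy r)) ⁻¹'
          (Set.Iic p.EuBar ×ˢ Set.Iic (max 0 (Abar - p.pushPower))) := by
      ext r
      simp [admissibleRadii, and_assoc]
    rw [this]
    exact (hp.continuousOn_unicastEnergy.prodMk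
      (hp.continuousOn_unicastEnergy.const_mul p.η)).preimage_isClosed_of_isClosed
        isClosed_Icc (isClosed_Iic.prod isClosed_Iic)
  have hne : (p.admissibleRadii Abar).Nonempty := by
    refine ⟨0, le_rfl, h0, ?_, ?_⟩
    · simpa [EuBar, unicastEnergy] using hp.unicastEnergy_nonneg h0
    · simp [unicastEnergy]
  have hbdd : BddAbove (p.admissibleRadii Abar) := ⟨p.R, fun r hr => hr.2.1⟩
  exact ⟨hcl.csSup_mem hne hbdd, fun r hr => le_csSup hbdd hr⟩

/-! ### Law of the request location -/

theorem Valid.isProbabilityMeasure_locationLaw (hp : p.Valid) :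
    IsProbabilityMeasure p.locationLaw :=
  cond_isProbabilityMeasure_of_finite
    (Metric.measure_closedBall_pos volume 0 hp.R_pos).ne' measure_closedBall_lt_top.ne

/-- The distance of a uniformly located user has density `2x/R²`. -/
theorem Valid.integral_norm_locationLaw (hp : p.Valid) (g : ℝ → ℝ) :
    ∫ z, g ‖z‖ ∂p.locationLaw = ∫ x in (0 : ℝ)..p.R, g x * (2 * x / p.R ^ 2) := by
  have hR := hp.R_pos
  have hV : (volume.real (Metric.ball (0 : EuclideanSpace ℝ (Fin 2)) 1)) ≠ 0 :=
    (ENNReal.toReal_pos (Metric.measure_ball_pos volume 0 one_pos).ne'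
      measure_ball_lt_top.ne).ne'
  have hball : volume.real (Metric.closedBall (0 : EuclideanSpace ℝ (Fin 2)) p.R)
      = p.R ^ 2 * volume.real (Metric.ball (0 : EuclideanSpace ℝ (Fin 2)) 1) := by
    rw [measureReal_def, Measure.addHaar_closedBall volume 0 hR.le, ENNReal.toReal_mul,
      ENNReal.toReal_ofReal (by positivity), finrank_euclideanSpace_fin, measureReal_def]
  have hind : ∀ z : EuclideanSpace ℝ (Fin 2), (Metric.closedBall 0 p.R).indicator (fun z => g ‖z‖) z
      = (Set.Iic p.R).indicator g ‖z‖ := by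
    intro z
    simp [Set.indicator]
  rw [locationLaw, ProbabilityTheory.cond, integral_smul_measure,
    ← integral_indicator Metric.isClosed_closedBall.measurableSet]
  simp_rw [hind]
  -- Polar coordinates; the volume of the unit ball cancels against the normalisation by the volume
  -- of the cell.
  rw [integral_fun_norm_addHaar, finrank_euclideanSpace_fin]
  have h1 : ∀ y : ℝ, y ^ (2 - 1) • (Set.Iic p.R).indicator g y
      = (Set.Iic p.R).indicator (fun y => y * g y) y := by
    intro y
    by_cases hy : y ≤ p.R <;> simp [Set.indicator, hy]
  simp_rw [h1]
  rw [setIntegral_indicator measurableSet_Iic, Set.Ioi_inter_Iic,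
    intervalIntegral.integral_of_le hR.le, ENNReal.toReal_inv, ← measureReal_def, hball]
  have h2 : ∀ x : ℝ, g x * (2 * x / p.R ^ 2) = (2 / p.R ^ 2) * (x * g x) := fun x => by ring
  simp_rw [h2]
  rw [integral_const_mul]
  simp only [smul_eq_mul, nsmul_eq_mul]
  field_simp
  push_cast
  ring

theorem Valid.integral_indicator_locationLaw (hp : p.Valid) {r : ℝ} (hr0 : 0 ≤ r) (hr : r ≤ p.R) :
    ∫ z, (if ‖z‖ ≤ r then (1 : ℝ) else 0) ∂p.locationLaw = r ^ 2 / p.R ^ 2 := by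
  rw [hp.integral_norm_locationLaw fun x => if x ≤ r then (1 : ℝ) else 0]
  have h1 : ∀ x : ℝ, (if x ≤ r then (1 : ℝ) else 0) * (2 * x / p.R ^ 2)
      = (Set.Iic r).indicator (fun x => (2 / p.R ^ 2) * x) x := by
    intro x
    by_cases hx : x ≤ r <;> simp [hx, Set.indicator]
    ring
  simp_rw [h1]
  rw [intervalIntegral.integral_of_le hp.R_pos.le, setIntegral_indicator measurableSet_Iic,
    Set.Ioc_inter_Iic, min_eq_right hr, ← intervalIntegral.integral_of_le hr0,
    intervalIntegral.integral_const_mul, integral_id]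
  ring

theorem Valid.integral_Eu_locationLaw (hp : p.Valid) {r : ℝ} (hr0 : 0 ≤ r) (hr : r ≤ p.R) :
    ∫ z, (if ‖z‖ ≤ r then p.Eu ‖z‖ else 0) ∂p.locationLaw = p.unicastEnergy r := by
  rw [hp.integral_norm_locationLaw fun x => if x ≤ r then p.Eu x else 0]
  have h1 : ∀ x : ℝ, (if x ≤ r then p.Eu x else 0) * (2 * x / p.R ^ 2)
      = (Set.Iic r).indicator (fun x => p.Eu x * (2 * x / p.R ^ 2)) x := by
    intro x
    by_cases hx : x ≤ r <;> simp [hx, Set.indicator]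
  simp_rw [h1]
  rw [intervalIntegral.integral_of_le hp.R_pos.le, setIntegral_indicator measurableSet_Iic,
    Set.Ioc_inter_Iic, min_eq_right hr, ← intervalIntegral.integral_of_le hr0, unicastEnergy]

end Model

/-! ### Discrete laws and expectations over one slot -/

theorem isProbabilityMeasure_bernoulliLaw {q : ℝ} (h0 : 0 ≤ q) (h1 : q ≤ 1) :
    IsProbabilityMeasure (bernoulliLaw q) := by
  constructor
  simp only [bernoulliLaw, Measure.coe_add, Measure.coe_smul, Pi.add_apply, Pi.smul_apply,
    measure_univ, smul_eq_mul, mul_one]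
  rw [← ENNReal.ofReal_add h0 (by linarith)]
  simp

theorem integral_bernoulliLaw {q : ℝ} (h0 : 0 ≤ q) (h1 : q ≤ 1) (g : Bool → ℝ) :
    ∫ b, g b ∂bernoulliLaw q = q * g true + (1 - q) * g false := by
  rw [bernoulliLaw, integral_add_measure, integral_smul_measure, integral_smul_measure,
    integral_dirac, integral_dirac, ENNReal.toReal_ofReal h0, ENNReal.toReal_ofReal (by linarith)]
  · simp
  · exact (integrable_dirac (by simp)).smul_measure ENNReal.ofReal_ne_top
  · exact (integrable_dirac (by simp)).smul_measure ENNReal.ofReal_ne_top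

theorem integral_sum_ofReal_smul_dirac {ι : Type*} (s : Finset ι) (w : ι → ℝ)
    (hw : ∀ i ∈ s, 0 ≤ w i) [MeasurableSpace ι] [MeasurableSingletonClass ι] (g : ι → ℝ) :
    ∫ i, g i ∂(∑ i ∈ s, ENNReal.ofReal (w i) • Measure.dirac i) = ∑ i ∈ s, w i * g i := by
  rw [integral_finsetSum_measure]
  · refine Finset.sum_congr rfl fun i hi => ?_
    rw [integral_smul_measure, integral_dirac, ENNReal.toReal_ofReal (hw i hi), smul_eq_mul]
  · exact fun i _ => (integrable_dirac (by simp)).smul_measure ENNReal.ofReal_ne_top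

theorem isProbabilityMeasure_sum_ofReal_smul_dirac {ι : Type*} (s : Finset ι) (w : ι → ℝ)
    (hw : ∀ i ∈ s, 0 ≤ w i) (h1 : ∑ i ∈ s, w i = 1) [MeasurableSpace ι] :
    IsProbabilityMeasure (∑ i ∈ s, ENNReal.ofReal (w i) • Measure.dirac i) := by
  constructor
  simp only [Measure.coe_finsetSum, Finset.sum_apply, Measure.coe_smul, Pi.smul_apply,
    measure_univ, smul_eq_mul, mul_one]
  rw [← ENNReal.ofReal_sum_of_nonneg hw, h1, ENNReal.ofReal_one]

namespace Model

variable {p : Model}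

theorem Valid.zipfNorm_pos (hp : p.Valid) : 0 < p.zipfNorm := by
  refine Finset.sum_pos (fun j hj => ?_) ⟨1, Finset.mem_Icc.2 ⟨le_rfl, hp.N_pos⟩⟩
  have : (0 : ℝ) < j := by exact_mod_cast (Finset.mem_Icc.1 hj).1
  positivity

theorem Valid.f_nonneg (hp : p.Valid) (i : ℕ) : 0 ≤ p.f i := by
  have := hp.zipfNorm_pos
  unfold f
  positivity

theorem Valid.sum_f (hp : p.Valid) : ∑ i ∈ Finset.Icc 1 p.N, p.f i = 1 := by
  simp only [f]
  rw [← Finset.sum_div]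
  exact div_self hp.zipfNorm_pos.ne'

theorem Valid.tail_eq_sum (hp : p.Valid) {c : ℕ} (hc : c ≤ p.N) :
    p.tail c = ∑ i ∈ Finset.Icc 1 p.N, p.f i * (if c < i then 1 else 0) := by
  have h1 : (Finset.Icc 1 p.N).filter (fun i => ¬ c < i) = Finset.Icc 1 c := by
    ext i
    simp only [Finset.mem_filter, Finset.mem_Icc]
    omega
  have h2 := Finset.sum_filter_add_sum_filter_not (Finset.Icc 1 p.N) (fun i => c < i) p.f
  rw [h1, hp.sum_f, Finset.sum_filter] at h2
  simp only [mul_ite, mul_one, mul_zero, tail]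
  linarith

theorem Valid.tail_nonneg (hp : p.Valid) {c : ℕ} (hc : c ≤ p.N) : 0 ≤ p.tail c := by
  rw [hp.tail_eq_sum hc]
  refine Finset.sum_nonneg fun i _ => ?_
  have := hp.f_nonneg i
  split_ifs <;> simp [this]

theorem Valid.tail_le_one (hp : p.Valid) (c : ℕ) : p.tail c ≤ 1 := by
  have := Finset.sum_nonneg fun i (_ : i ∈ Finset.Icc 1 c) => hp.f_nonneg i
  unfold tail
  linarith

theorem Valid.isProbabilityMeasure_rankLaw (hp : p.Valid) : IsProbabilityMeasure p.rankLaw :=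
  isProbabilityMeasure_sum_ofReal_smul_dirac _ _ (fun i _ => hp.f_nonneg i) hp.sum_f

theorem Valid.isProbabilityMeasure_replacedLaw (hp : p.Valid) :
    IsProbabilityMeasure p.replacedLaw := by
  refine isProbabilityMeasure_sum_ofReal_smul_dirac _ _ (fun i _ => by positivity) ?_
  have : (p.N : ℝ) ≠ 0 := by exact_mod_cast hp.N_pos.ne'
  simp [this]

theorem Valid.isProbabilityMeasure_slotLaw (hp : p.Valid) (ν : Measure ℝ)
    [IsProbabilityMeasure ν] : IsProbabilityMeasure (p.slotLaw ν) := by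
  have := isProbabilityMeasure_bernoulliLaw hp.pu_nonneg hp.pu_le_one
  have := isProbabilityMeasure_bernoulliLaw hp.pc_pos.le hp.pc_le_one
  have := hp.isProbabilityMeasure_rankLaw
  have := hp.isProbabilityMeasure_replacedLaw
  have := hp.isProbabilityMeasure_locationLaw
  unfold slotLaw
  infer_instance

/-- Independence of the slot components in factored form; the elementary probabilities below come
from it by putting `1` or an indicator in each factor. -/
theorem Valid.integral_slotLaw_mul (hp : p.Valid) (ν : Measure ℝ) [IsProbabilityMeasure ν]
    (a : ℝ → ℝ) (b : Bool → ℝ) (n : ℕ → ℝ) (ψ : EuclideanSpace ℝ (Fin 2) → ℝ) (t : Bool → ℝ)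
    (l : ℕ → ℝ) :
    ∫ s, a s.harvest * (b s.request * (n s.rank * (ψ s.location * (t s.replace * l s.replaced))))
      ∂p.slotLaw ν
    = (∫ x, a x ∂ν) * ((p.pu * b true + (1 - p.pu) * b false) *
      ((∑ i ∈ Finset.Icc 1 p.N, p.f i * n i) * ((∫ z, ψ z ∂p.locationLaw) *
      ((p.pc * t true + (1 - p.pc) * t false) * ∑ i ∈ Finset.Icc 1 p.N, 1 / (p.N : ℝ) * l i)))) := by
  have := isProbabilityMeasure_bernoulliLaw hp.pu_nonneg hp.pu_le_one
  have := isProbabilityMeasure_bernoulliLaw hp.pc_pos.le hp.pc_le_one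
  have := hp.isProbabilityMeasure_rankLaw
  have := hp.isProbabilityMeasure_replacedLaw
  have := hp.isProbabilityMeasure_locationLaw
  rw [← integral_bernoulliLaw hp.pu_nonneg hp.pu_le_one, ← integral_bernoulliLaw hp.pc_pos.le
    hp.pc_le_one, ← integral_sum_ofReal_smul_dirac _ _ fun i _ => hp.f_nonneg i,
    ← integral_sum_ofReal_smul_dirac _ _ fun i _ => by positivity]
  change _ = (∫ x, a x ∂ν) * ((∫ x, b x ∂bernoulliLaw p.pu) * ((∫ x, n x ∂p.rankLaw) *
    ((∫ z, ψ z ∂p.locationLaw) * ((∫ x, t x ∂bernoulliLaw p.pc) * ∫ x, l x ∂p.replacedLaw))))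
  rw [← integral_prod_mul t l, ← integral_prod_mul ψ, ← integral_prod_mul n, ← integral_prod_mul b,
    ← integral_prod_mul a]
  rfl

theorem Valid.sum_inv_N (hp : p.Valid) :
    ∑ i ∈ Finset.Icc 1 p.N, 1 / (p.N : ℝ) * (fun _ => (1 : ℝ)) i = 1 := by
  have : (p.N : ℝ) ≠ 0 := by exact_mod_cast hp.N_pos.ne'
  simp [this]

theorem Valid.integral_harvest (hp : p.Valid) (ν : Measure ℝ) [IsProbabilityMeasure ν]
    (a : ℝ → ℝ) : ∫ s, a s.harvest ∂p.slotLaw ν = ∫ x, a x ∂ν := by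
  have := hp.isProbabilityMeasure_locationLaw
  have h := hp.integral_slotLaw_mul ν a (fun _ => 1) (fun _ => 1) (fun _ => 1) (fun _ => 1)
    (fun _ => 1)
  rw [hp.sum_inv_N] at h
  simpa [hp.sum_f] using h

theorem Valid.integral_request (hp : p.Valid) (ν : Measure ℝ) [IsProbabilityMeasure ν]
    {P : ℕ → Prop} [DecidablePred P] (ψ : EuclideanSpace ℝ (Fin 2) → ℝ) :
    ∫ s : Slot, (if s.request = true ∧ P s.rank then ψ s.location else 0) ∂p.slotLaw ν
    = p.pu * (∑ i ∈ Finset.Icc 1 p.N, p.f i * (if P i then 1 else 0)) *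
      ∫ z, ψ z ∂p.locationLaw := by
  have h := hp.integral_slotLaw_mul ν (fun _ => 1) (fun b => if b = true then 1 else 0)
    (fun i => if P i then 1 else 0) ψ (fun _ => 1) (fun _ => 1)
  rw [hp.sum_inv_N] at h
  simp only [integral_const, probReal_univ, smul_eq_mul, mul_one, one_mul, if_true,
    Bool.false_eq_true, if_false, mul_zero, add_zero, add_sub_cancel] at h
  rw [mul_assoc, ← h]
  refine integral_congr_ae (ae_of_all _ fun s => ?_)
  by_cases h1 : s.request = true <;> by_cases h2 : P s.rank <;> simp [h1, h2]

theorem Valid.integral_request_tail (hp : p.Valid) (ν : Measure ℝ) [IsProbabilityMeasure ν]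
    {c : ℕ} (hc : c ≤ p.N) (ψ : EuclideanSpace ℝ (Fin 2) → ℝ) :
    ∫ s : Slot, (if s.request = true ∧ c < s.rank then ψ s.location else 0) ∂p.slotLaw ν
    = p.pu * p.tail c * ∫ z, ψ z ∂p.locationLaw := by
  rw [hp.integral_request ν ψ, hp.tail_eq_sum hc]

theorem Valid.integral_removed (hp : p.Valid) (ν : Measure ℝ) [IsProbabilityMeasure ν]
    {c : ℕ} (hc : c ≤ p.N) :
    ∫ s : Slot, (if s.replace = true ∧ s.replaced ≤ c then (1 : ℝ) else 0) ∂p.slotLaw ν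
    = p.pc * c / p.N := by
  have := hp.isProbabilityMeasure_locationLaw
  have h := hp.integral_slotLaw_mul ν (fun _ => 1) (fun _ => 1) (fun _ => 1) (fun _ => 1)
    (fun b => if b = true then 1 else 0) (fun i => if i ≤ c then 1 else 0)
  have h3 : ∑ i ∈ Finset.Icc 1 p.N, 1 / (p.N : ℝ) * (if i ≤ c then 1 else 0) = c / p.N := by
    rw [← Finset.mul_sum, ← Finset.sum_filter]
    have : (Finset.Icc 1 p.N).filter (fun i => i ≤ c) = Finset.Icc 1 c := by
      ext i
      simp only [Finset.mem_filter, Finset.mem_Icc]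
      omega
    rw [this]
    simp
    ring
  rw [h3] at h
  simp only [integral_const, probReal_univ, smul_eq_mul, mul_one, one_mul, if_true,
    Bool.false_eq_true, if_false, mul_zero, add_zero, add_sub_cancel, hp.sum_f] at h
  rw [mul_div_assoc, ← h]
  refine integral_congr_ae (ae_of_all _ fun s => ?_)
  by_cases h1 : s.replace = true <;> by_cases h2 : s.replaced ≤ c <;> simp [h1, h2]

/-! ### Measurability -/

theorem measurable_harvest : Measurable Slot.harvest := measurable_fst

theorem measurable_request : Measurable Slot.request := measurable_fst.comp measurable_snd

theorem measurable_rank : Measurable Slot.rank :=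
  measurable_fst.comp (measurable_snd.comp measurable_snd)

theorem measurable_location : Measurable Slot.location :=
  measurable_fst.comp (measurable_snd.comp (measurable_snd.comp measurable_snd))

theorem measurable_replace : Measurable Slot.replace :=
  measurable_fst.comp (measurable_snd.comp (measurable_snd.comp
    (measurable_snd.comp measurable_snd)))

theorem measurable_replaced : Measurable Slot.replaced :=
  measurable_snd.comp (measurable_snd.comp (measurable_snd.comp
    (measurable_snd.comp measurable_snd)))

theorem Valid.measurable_Q (hp : p.Valid) :
    Measurable fun z : (ℝ × ℕ) × Slot => p.Q z.1.2 z.2 := by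
  unfold Q
  refine Measurable.ite (MeasurableSet.inter ?_ ?_) ?_ measurable_const
  · exact (measurable_request.comp measurable_snd) (measurableSet_singleton true)
  · exact measurableSet_lt (measurable_snd.comp measurable_fst) (measurable_rank.comp measurable_snd)
  · exact hp.measurable_Eu_norm.comp (measurable_location.comp measurable_snd)

theorem act_eq_push_iff {d : ℝ} {x : ℝ × ℕ} {s : Slot} :
    p.act d x s = Action.push ↔ x.2 < p.Cthr ∧ p.Ep ≤ x.1 := by
  unfold act eetb
  split_ifs <;> simp_all

theorem act_eq_unicast_iff {d : ℝ} {x : ℝ × ℕ} {s : Slot} :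
    p.act d x s = Action.unicast ↔
      ¬ x.2 < p.Cthr ∧ 0 < p.Q x.2 s ∧ p.Q x.2 s ≤ p.Eu d ∧ p.Q x.2 s ≤ x.1 := by
  unfold act eetb
  split_ifs <;> simp_all

theorem energyUsed_act_eq (d : ℝ) (x : ℝ × ℕ) (s : Slot) :
    p.energyUsed (p.Q x.2 s) (p.act d x s) = (if p.act d x s = Action.push then p.Ep else 0)
      + if p.act d x s = Action.unicast then p.Q x.2 s else 0 := by
  cases h : p.act d x s <;> simp [energyUsed]

theorem measurableSet_push (d : ℝ) :
    MeasurableSet {z : (ℝ × ℕ) × Slot | p.act d z.1 z.2 = Action.push} := by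
  simp only [act_eq_push_iff]
  exact (measurableSet_lt (measurable_snd.comp measurable_fst) measurable_const).inter
    (measurableSet_le measurable_const (measurable_fst.comp measurable_fst))

theorem Valid.measurableSet_unicast (hp : p.Valid) (d : ℝ) :
    MeasurableSet {z : (ℝ × ℕ) × Slot | p.act d z.1 z.2 = Action.unicast} := by
  simp only [act_eq_unicast_iff]
  exact (measurableSet_lt (measurable_snd.comp measurable_fst) measurable_const).compl.inter
    ((measurableSet_lt measurable_const hp.measurable_Q).inter
      ((measurableSet_le hp.measurable_Q measurable_const).inter
        (measurableSet_le hp.measurable_Q (measurable_fst.comp measurable_fst))))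

theorem Valid.measurable_energyUsed (hp : p.Valid) (d : ℝ) :
    Measurable fun z : (ℝ × ℕ) × Slot => p.energyUsed (p.Q z.1.2 z.2) (p.act d z.1 z.2) := by
  simp only [energyUsed_act_eq]
  exact (Measurable.ite (measurableSet_push d) measurable_const measurable_const).add
    (Measurable.ite (hp.measurableSet_unicast d) hp.measurable_Q measurable_const)

theorem measurable_pushed (d : ℝ) : Measurable fun z : (ℝ × ℕ) × Slot =>
    z.1.2 + (if p.act d z.1 z.2 = Action.push then 1 else 0)
      - (if z.2.replace = true ∧ z.2.replaced ≤ z.1.2 then 1 else 0) := by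
  refine ((measurable_snd.comp measurable_fst).add
    (Measurable.ite (measurableSet_push d) measurable_const measurable_const)).sub
    (Measurable.ite (MeasurableSet.inter ?_ ?_) measurable_const measurable_const)
  · exact (measurable_replace.comp measurable_snd) (measurableSet_singleton true)
  · exact measurableSet_le (measurable_replaced.comp measurable_snd)
      (measurable_snd.comp measurable_fst)

theorem Valid.measurable_step (hp : p.Valid) (B : EReal) (d : ℝ) :
    Measurable (Function.uncurry (p.step B d)) := by
  refine Measurable.prodMk ?_ (measurable_pushed d)
  refine measurable_ereal_toReal.comp (measurable_const.min (measurable_coe_real_ereal.comp ?_))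
  exact ((measurable_fst.comp measurable_fst).sub (hp.measurable_energyUsed d)).add
    (measurable_harvest.comp measurable_snd)

theorem Valid.measurableSet_blocked (hp : p.Valid) (d : ℝ) :
    MeasurableSet {z : (ℝ × ℕ) × Slot | p.Blocked d z.1 z.2} := by
  refine (measurableSet_lt measurable_const hp.measurable_Q).inter
    ((hp.measurableSet_unicast d).compl.inter
      (MeasurableSet.inter ?_ (measurableSet_push d)).compl)
  have hc : Measurable fun z : (ℝ × ℕ) × Slot => z.1.2 + 1 := by
    fun_prop
  exact measurableSet_eq_fun (measurable_rank.comp measurable_snd) hc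

end Model

/-! ### Energy value, surplus and one-slot means -/

namespace Model

variable (p : Model)

/-- Probability that a given content is replaced in a slot. -/
noncomputable def replaceProb : ℝ := p.pc / p.N

/-- Mean unicast energy per slot when `Cthr` contents are pushed and energy is abundant. -/
noncomputable def unicastMean (d : ℝ) : ℝ := p.pu * p.tail p.Cthr * p.unicastEnergy d

/-- Energy value of having `Cthr` rather than `Cthr - 1` contents pushed. -/
noncomputable def pushValue (d : ℝ) : ℝ := (p.Ep - p.unicastMean d) / (1 + p.replaceProb)

/-- Mean energy spent per slot when energy is abundant. -/
noncomputable def demand (d : ℝ) : ℝ :=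
  p.unicastMean d + p.replaceProb * p.Cthr * p.pushValue d

/-- Energy value of the number of pushed contents, which makes the mean change of stored energy plus
value constant as long as energy is abundant. -/
noncomputable def contentValue (d : ℝ) (c : ℕ) : ℝ :=
  if p.Cthr ≤ c then
    p.pushValue d - p.Eu d / p.replaceProb * ((min c p.N - p.Cthr : ℕ) : ℝ)
  else -(max (p.pushValue d) 0 * ((p.Cthr - 1 - c : ℕ) : ℝ))

/-- A bound of `contentValue`. -/
noncomputable def valueBound (d : ℝ) : ℝ :=
  |p.pushValue d| + p.Eu d / p.replaceProb * p.N + |p.pushValue d| * p.N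

/-- Mean number of pushed contents, weighted by `ψ`, after a slot. -/
noncomputable def pushedMean (ψ : ℕ → ℝ) (x : ℝ × ℕ) : ℝ :=
  (1 - p.replaceProb * x.2) * ψ (x.2 + if x.2 < p.Cthr ∧ p.Ep ≤ x.1 then 1 else 0)
    + p.replaceProb * x.2 * ψ (x.2 + (if x.2 < p.Cthr ∧ p.Ep ≤ x.1 then 1 else 0) - 1)

/-- Mean change of stored energy plus content value in a slot without harvest, relative to the
abundant regime. -/
noncomputable def surplus (ν : Measure ℝ) (d : ℝ) (x : ℝ × ℕ) : ℝ :=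
  p.demand d - ∫ s, p.energyUsed (p.Q x.2 s) (p.act d x s) ∂p.slotLaw ν
    + (p.pushedMean (p.contentValue d) x - p.contentValue d x.2)

/-- Mean unicast energy that is not delivered for lack of stored energy `E`. -/
noncomputable def lostEnergy (ν : Measure ℝ) (d E : ℝ) : ℝ :=
  ∫ s : Slot, (if s.request = true ∧ p.Cthr < s.rank then
    (if p.Eu ‖s.location‖ ≤ p.Eu d ∧ E < p.Eu ‖s.location‖ then p.Eu ‖s.location‖ else 0)
    else 0) ∂p.slotLaw ν

/-- Probability of blocking in a slot. -/
noncomputable def blockProb (ν : Measure ℝ) (d : ℝ) (x : ℝ × ℕ) : ℝ :=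
  (p.slotLaw ν).real {s | p.Blocked d x s}

/-- Change of the expected number of blocked requests due to having `Cthr` rather than `Cthr - 1`
contents pushed. -/
noncomputable def blockGain (d : ℝ) : ℝ :=
  -(p.pu * p.tail p.Cthr * (d ^ 2 / p.R ^ 2)) / (1 + p.replaceProb)

/-- Solution of the Poisson equation for blocking when energy is abundant. -/
noncomputable def blockValue (d : ℝ) (c : ℕ) : ℝ := if p.Cthr ≤ c then p.blockGain d else 0

/-- The blocking probability with unicast radius `d` when energy is abundant. -/
noncomputable def pblkRadius (d : ℝ) : ℝ :=
  p.pblkLB p.Cthr + p.η * ((p.R ^ 2 - d ^ 2) / p.R ^ 2)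

variable {p} {ν : Measure ℝ} {d : ℝ}

theorem Cthr_le_N : p.Cthr ≤ p.N := min_le_left _ _

theorem Valid.N_pos' (hp : p.Valid) : (0 : ℝ) < p.N := by exact_mod_cast hp.N_pos

theorem Valid.replaceProb_pos (hp : p.Valid) : 0 < p.replaceProb :=
  div_pos hp.pc_pos hp.N_pos'

theorem Valid.replaceProb_mul_le_one (hp : p.Valid) {c : ℕ} (hc : c ≤ p.N) :
    p.replaceProb * c ≤ 1 := by
  have h1 : (c : ℝ) ≤ p.N := by exact_mod_cast hc
  rw [replaceProb, div_mul_eq_mul_div, div_le_one hp.N_pos']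
  nlinarith [hp.pc_le_one, hp.pc_pos, hp.N_pos']

theorem Valid.replaceProb_mul_lt_one (hp : p.Valid) {c : ℕ} (hc : c < p.N) :
    p.replaceProb * c < 1 := by
  have h1 : (c : ℝ) < p.N := by exact_mod_cast hc
  rw [replaceProb, div_mul_eq_mul_div, div_lt_one hp.N_pos']
  nlinarith [hp.pc_le_one, hp.pc_pos, hp.N_pos', (Nat.cast_nonneg c : (0 : ℝ) ≤ c)]

theorem Valid.unicastMean_nonneg (hp : p.Valid) (hd : 0 ≤ d) : 0 ≤ p.unicastMean d :=
  mul_nonneg (mul_nonneg hp.pu_nonneg (hp.tail_nonneg Cthr_le_N)) (hp.unicastEnergy_nonneg hd)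

theorem Valid.unicastMean_eq (hp : p.Valid) (d : ℝ) :
    p.unicastMean d = p.Ep - (1 + p.replaceProb) * p.pushValue d := by
  have := hp.replaceProb_pos
  rw [pushValue]
  field_simp
  ring

theorem Valid.demand_eq (hp : p.Valid) (d : ℝ) :
    p.demand d = p.Ep - (1 - p.replaceProb * (p.Cthr - 1)) * p.pushValue d := by
  rw [demand, hp.unicastMean_eq]
  ring

/-- Here the potential-theoretic demand becomes the stationary one: `1 / (1 + q) = N / (N + pc)`
produces the weights of the states `Cthr - 1` and `Cthr`. -/
theorem Valid.demand_eq_pushPower_add (hp : p.Valid) (d : ℝ) :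
    p.demand d = p.pushPower + p.η * p.unicastEnergy d := by
  have h1 := hp.N_pos'
  have h2 := hp.pc_pos
  have h3 : (p.N : ℝ) + p.pc ≠ 0 := by positivity
  have h4 : 1 + p.pc / (p.N : ℝ) ≠ 0 := by positivity
  rw [demand, pushValue, replaceProb, pushPower, η, unicastMean]
  field_simp
  ring

/-- The bounded quantity is the surplus in a state that cannot afford its push. Its uniform
positivity is what makes starvation costly for the quadratic potential. -/
theorem Valid.exists_demand_gap (hp : p.Valid) (hd : 0 ≤ d) : ∃ δ : ℝ, 0 < δ ∧
    ∀ c : ℕ, c < p.Cthr → δ ≤ p.demand d - p.replaceProb * c * max (p.pushValue d) 0 := by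
  have hu := hp.unicastMean_nonneg hd
  have hue := hp.unicastMean_eq d
  have hq := hp.replaceProb_pos
  have hE := hp.Ep_pos
  rcases le_or_gt 0 (p.pushValue d) with h | h
  · refine ⟨p.unicastMean d + p.replaceProb * p.pushValue d, ?_, fun c hc => ?_⟩
    -- If a push has energy value zero, the mean unicast energy equals `Ep`, so the bound is still
    -- positive.
    · rcases h.eq_or_lt with h0 | h0
      · rw [← h0] at hue ⊢
        linarith
      · have := mul_pos hq h0
        linarith
    · have hc' : (c : ℝ) + 1 ≤ p.Cthr := by exact_mod_cast hc
      rw [max_eq_left h, demand]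
      nlinarith [mul_nonneg hq.le h]
  · refine ⟨p.Ep, hE, fun c hc => ?_⟩
    rw [max_eq_right h.le, hp.demand_eq]
    have h1 : ((p.Cthr - 1 : ℕ) : ℝ) = p.Cthr - 1 := by
      rw [Nat.cast_sub (by omega), Nat.cast_one]
    have h2 := hp.replaceProb_mul_le_one (c := p.Cthr - 1) (by have := p.Cthr_le_N; omega)
    rw [h1] at h2
    nlinarith

theorem Valid.abs_contentValue_le (hp : p.Valid) (hd : 0 ≤ d) (c : ℕ) :
    |p.contentValue d c| ≤ p.valueBound d := by
  have hq := hp.replaceProb_pos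
  have hE := hp.Eu_nonneg hd
  have h0 : 0 ≤ p.Eu d / p.replaceProb := by positivity
  have hN := hp.N_pos'
  have h1 : ((min c p.N - p.Cthr : ℕ) : ℝ) ≤ p.N := by
    exact_mod_cast (Nat.sub_le _ _).trans (min_le_right _ _)
  have h2 : ((p.Cthr - 1 - c : ℕ) : ℝ) ≤ p.N := by
    have := p.Cthr_le_N
    exact_mod_cast (by omega : p.Cthr - 1 - c ≤ p.N)
  have h3 : max (p.pushValue d) 0 ≤ |p.pushValue d| := max_le (le_abs_self _) (abs_nonneg _)
  have h4 := mul_le_mul_of_nonneg_left h1 h0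
  have h5 := mul_le_mul h3 h2 (Nat.cast_nonneg _) (abs_nonneg _)
  have h6 := mul_nonneg (le_max_right (p.pushValue d) 0)
    (Nat.cast_nonneg (p.Cthr - 1 - c) : (0 : ℝ) ≤ _)
  have h7 := mul_nonneg h0 (Nat.cast_nonneg (min c p.N - p.Cthr) : (0 : ℝ) ≤ _)
  have h8 := mul_nonneg h0 hN.le
  have h9 := mul_nonneg (abs_nonneg (p.pushValue d)) hN.le
  have h10 := neg_abs_le (p.pushValue d)
  have h11 := le_abs_self (p.pushValue d)
  unfold contentValue valueBound
  rw [abs_le]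
  split_ifs <;> constructor <;> linarith [abs_nonneg (p.pushValue d)]

theorem Valid.valueBound_nonneg (hp : p.Valid) (hd : 0 ≤ d) : 0 ≤ p.valueBound d :=
  (abs_nonneg _).trans (hp.abs_contentValue_le hd 0)

theorem step_snd (B : EReal) (d : ℝ) (x : ℝ × ℕ) (s : Slot) : (p.step B d x s).2 =
    x.2 + (if x.2 < p.Cthr ∧ p.Ep ≤ x.1 then 1 else 0)
      - (if s.replace = true ∧ s.replaced ≤ x.2 then 1 else 0) := by
  simp only [step, act_eq_push_iff]

theorem step_snd_le (B : EReal) (d : ℝ) {x : ℝ × ℕ} (hx : x.2 ≤ p.N) (s : Slot) :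
    (p.step B d x s).2 ≤ p.N := by
  have := p.Cthr_le_N
  rw [step_snd]
  split_ifs <;> omega

theorem measurable_slot_of_pair {β : Type*} [MeasurableSpace β] {g : (ℝ × ℕ) × Slot → β}
    (hg : Measurable g) (x : ℝ × ℕ) : Measurable fun s => g (x, s) :=
  hg.comp measurable_prodMk_left

theorem Valid.measurable_step_snd (hp : p.Valid) (B : EReal) (d : ℝ) (x : ℝ × ℕ) :
    Measurable fun s => (p.step B d x s).2 :=
  measurable_snd.comp (measurable_slot_of_pair (hp.measurable_step B d) x)

theorem measurableSet_removed (c : ℕ) :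
    MeasurableSet {s : Slot | s.replace = true ∧ s.replaced ≤ c} :=
  (measurable_replace (measurableSet_singleton true)).inter
    (measurableSet_le measurable_replaced measurable_const)

/-- Whether a push takes place is determined by the state alone, so removal, of probability `q *
x.2`, is the only randomness in the content count. -/
theorem Valid.integral_step_snd (hp : p.Valid) [IsProbabilityMeasure ν] (B : EReal) (d : ℝ)
    (ψ : ℕ → ℝ) {x : ℝ × ℕ} (hx : x.2 ≤ p.N) :
    ∫ s, ψ (p.step B d x s).2 ∂p.slotLaw ν = p.pushedMean ψ x := by
  have := hp.isProbabilityMeasure_slotLaw ν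
  set c' := x.2 + if x.2 < p.Cthr ∧ p.Ep ≤ x.1 then 1 else 0 with hc'
  have h1 : ∀ s, ψ (p.step B d x s).2 = ψ c' +
      (if s.replace = true ∧ s.replaced ≤ x.2 then (1 : ℝ) else 0) * (ψ (c' - 1) - ψ c') := by
    intro s
    rw [step_snd, ← hc']
    by_cases h : s.replace = true ∧ s.replaced ≤ x.2 <;> simp [h]
  simp_rw [h1]
  rw [integral_add (integrable_const _), integral_mul_const, hp.integral_removed ν hx, pushedMean,
    ← hc', replaceProb]
  · simp
    ring
  · refine Integrable.mul_const ?_ _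
    refine Integrable.of_bound (Measurable.ite (measurableSet_removed x.2) measurable_const
      measurable_const).aestronglyMeasurable 1 (ae_of_all _ fun s => ?_)
    split_ifs <;> simp

theorem Valid.Q_nonneg (hp : p.Valid) (c : ℕ) (s : Slot) : 0 ≤ p.Q c s := by
  have := hp.Eu_nonneg (norm_nonneg s.location)
  unfold Q
  split_ifs <;> simp [this]

theorem Valid.energyUsed_nonneg (hp : p.Valid) (d : ℝ) (x : ℝ × ℕ) (s : Slot) :
    0 ≤ p.energyUsed (p.Q x.2 s) (p.act d x s) := by
  have h1 := hp.Q_nonneg x.2 s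
  have h2 := hp.Ep_pos.le
  cases p.act d x s <;> simp [energyUsed, h1, h2]

theorem Valid.energyUsed_le (hp : p.Valid) (hd : 0 ≤ d) (x : ℝ × ℕ) (s : Slot) :
    p.energyUsed (p.Q x.2 s) (p.act d x s) ≤ p.Ep + p.Eu d := by
  have h1 := hp.Eu_nonneg hd
  have h2 := hp.Ep_pos.le
  cases h : p.act d x s with
  | sleep => simp only [energyUsed]; linarith
  | unicast =>
    have := (act_eq_unicast_iff.1 h).2.2.1
    simp only [energyUsed]; linarith
  | push => simp only [energyUsed]; linarith

theorem energyUsed_le_energy (d : ℝ) {x : ℝ × ℕ} (hx : 0 ≤ x.1) (s : Slot) :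
    p.energyUsed (p.Q x.2 s) (p.act d x s) ≤ x.1 := by
  cases h : p.act d x s with
  | sleep => simpa only [energyUsed] using hx
  | unicast => exact (act_eq_unicast_iff.1 h).2.2.2
  | push => exact (act_eq_push_iff.1 h).2

theorem Valid.integrable_energyUsed (hp : p.Valid) [IsProbabilityMeasure ν] (hd : 0 ≤ d)
    (x : ℝ × ℕ) :
    Integrable (fun s => p.energyUsed (p.Q x.2 s) (p.act d x s)) (p.slotLaw ν) := by
  have := hp.isProbabilityMeasure_slotLaw ν
  refine Integrable.of_bound
    (measurable_slot_of_pair (hp.measurable_energyUsed d) x).aestronglyMeasurable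
    (p.Ep + p.Eu d) (ae_of_all _ fun s => ?_)
  rw [Real.norm_eq_abs, abs_of_nonneg (hp.energyUsed_nonneg d x s)]
  exact hp.energyUsed_le hd x s

theorem Valid.integral_energyUsed_of_push (hp : p.Valid) [IsProbabilityMeasure ν] {x : ℝ × ℕ}
    (h1 : x.2 < p.Cthr) (h2 : p.Ep ≤ x.1) :
    ∫ s, p.energyUsed (p.Q x.2 s) (p.act d x s) ∂p.slotLaw ν = p.Ep := by
  have := hp.isProbabilityMeasure_slotLaw ν
  have h : ∀ s, p.act d x s = Action.push := fun s => act_eq_push_iff.2 ⟨h1, h2⟩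
  simp [h, energyUsed]

theorem integral_energyUsed_of_starved {x : ℝ × ℕ}
    (h1 : x.2 < p.Cthr) (h2 : x.1 < p.Ep) :
    ∫ s, p.energyUsed (p.Q x.2 s) (p.act d x s) ∂p.slotLaw ν = 0 := by
  have h : ∀ s, p.act d x s = Action.sleep := fun s => by
    simp [act, eetb, h1, not_le.2 h2]
  simp [h, energyUsed]

theorem Valid.integral_energyUsed_of_ge (hp : p.Valid) [IsProbabilityMeasure ν] (hd : 0 ≤ d)
    {x : ℝ × ℕ} (h1 : p.Cthr ≤ x.2) :
    ∫ s, p.energyUsed (p.Q x.2 s) (p.act d x s) ∂p.slotLaw ν ≤ p.Eu d := by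
  have := hp.isProbabilityMeasure_slotLaw ν
  have h0 := hp.Eu_nonneg hd
  calc ∫ s, p.energyUsed (p.Q x.2 s) (p.act d x s) ∂p.slotLaw ν
      ≤ ∫ _, p.Eu d ∂p.slotLaw ν := by
        refine integral_mono (hp.integrable_energyUsed hd x) (integrable_const _) fun s => ?_
        simp only
        cases h : p.act d x s with
        | sleep => simpa only [energyUsed] using h0
        | unicast => exact (act_eq_unicast_iff.1 h).2.2.1
        | push => exact absurd (act_eq_push_iff.1 h).1 (not_lt.2 h1)
    _ = p.Eu d := by simp

theorem measurable_ite_request (c : ℕ)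
    {ψ : EuclideanSpace ℝ (Fin 2) → ℝ} (hψ : Measurable ψ) :
    Measurable fun s : Slot => if s.request = true ∧ c < s.rank then ψ s.location else 0 := by
  refine Measurable.ite (MeasurableSet.inter ?_ ?_) (hψ.comp measurable_location) measurable_const
  · exact measurable_request (measurableSet_singleton true)
  · exact measurableSet_lt measurable_const measurable_rank

theorem Valid.measurable_lost (hp : p.Valid) (d E : ℝ) :
    Measurable fun z : EuclideanSpace ℝ (Fin 2) =>
      if p.Eu ‖z‖ ≤ p.Eu d ∧ E < p.Eu ‖z‖ then p.Eu ‖z‖ else 0 :=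
  Measurable.ite ((measurableSet_le hp.measurable_Eu_norm measurable_const).inter
    (measurableSet_lt measurable_const hp.measurable_Eu_norm)) hp.measurable_Eu_norm
    measurable_const

theorem Valid.integrable_lost (hp : p.Valid) [IsProbabilityMeasure ν] (hd : 0 ≤ d) (E : ℝ) :
    Integrable (fun s : Slot => if s.request = true ∧ p.Cthr < s.rank then
      (if p.Eu ‖s.location‖ ≤ p.Eu d ∧ E < p.Eu ‖s.location‖ then p.Eu ‖s.location‖ else 0)
      else 0) (p.slotLaw ν) := by
  have := hp.isProbabilityMeasure_slotLaw ν
  refine Integrable.of_bound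
    (measurable_ite_request p.Cthr (hp.measurable_lost d E)).aestronglyMeasurable (p.Eu d)
    (ae_of_all _ fun s => ?_)
  have h0 := hp.Eu_nonneg hd
  have h1 := hp.Eu_nonneg (norm_nonneg s.location)
  split_ifs with h2 h3
  · rw [Real.norm_eq_abs, abs_of_nonneg h1]
    exact h3.1
  · simpa using h0
  · simpa using h0

theorem Valid.lostEnergy_nonneg (hp : p.Valid) (ν : Measure ℝ) (d E : ℝ) :
    0 ≤ p.lostEnergy ν d E := by
  refine integral_nonneg fun s => ?_
  have h1 := hp.Eu_nonneg (norm_nonneg s.location)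
  simp only [Pi.zero_apply]
  split_ifs <;> simp [h1]

theorem lostEnergy_eq_zero {E : ℝ} (h : p.Eu d ≤ E) : p.lostEnergy ν d E = 0 := by
  refine integral_eq_zero_of_ae (ae_of_all _ fun s => ?_)
  have : ¬ (p.Eu ‖s.location‖ ≤ p.Eu d ∧ E < p.Eu ‖s.location‖) := fun h' => by
    linarith [h'.1, h'.2]
  simp [this]

/-- Each request for an unpushed content from within the radius is either served or too expensive
for the stored energy. -/
theorem Valid.integral_energyUsed_of_eq (hp : p.Valid) [IsProbabilityMeasure ν] (hd : 0 ≤ d)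
    (hdR : d ≤ p.R) {x : ℝ × ℕ} (h1 : x.2 = p.Cthr) :
    ∫ s, p.energyUsed (p.Q x.2 s) (p.act d x s) ∂p.slotLaw ν
      = p.unicastMean d - p.lostEnergy ν d x.1 := by
  have h := hp.integral_request_tail ν (p.Cthr_le_N)
    (fun z => if ‖z‖ ≤ d then p.Eu ‖z‖ else 0)
  rw [hp.integral_Eu_locationLaw hd hdR] at h
  rw [unicastMean, ← h, lostEnergy, eq_sub_iff_add_eq,
    ← integral_add (hp.integrable_energyUsed hd x) (hp.integrable_lost hd _)]
  refine integral_congr_ae (ae_of_all _ fun s => ?_)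
  have hE := hp.Eu_le_Eu (norm_nonneg s.location) hd
  have hE0 := hp.Eu_nonneg (norm_nonneg s.location)
  have hnp : p.act d x s ≠ Action.push := fun h => by
    have := (act_eq_push_iff.1 h).1
    omega
  simp only [energyUsed_act_eq]
  simp only [hnp, if_false, zero_add, act_eq_unicast_iff, h1, lt_irrefl, not_false_eq_true,
    true_and, Q]
  by_cases hr : s.request = true ∧ p.Cthr < s.rank
  · simp only [hr, and_self, if_true, ← hE]
    by_cases ha : p.Eu ‖s.location‖ ≤ p.Eu d
    · by_cases hb : x.1 < p.Eu ‖s.location‖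
      · simp [ha, hb, not_le.2 hb]
      -- A request located at the base station costs nothing and is not unicast; it contributes zero
      -- to both sides.
      · rcases hE0.eq_or_lt with h' | h'
        · simp [← h']
        · simp [ha, hb, not_lt.1 hb, h']
    · simp [ha]
  · simp [hr]

end Model

/-! ### Sign of the surplus in the various states -/

namespace Model

variable {p : Model} {ν : Measure ℝ} {d : ℝ}

theorem pushedMean_of_push (ψ : ℕ → ℝ) {x : ℝ × ℕ} (h1 : x.2 < p.Cthr) (h2 : p.Ep ≤ x.1) :
    p.pushedMean ψ x = (1 - p.replaceProb * x.2) * ψ (x.2 + 1) + p.replaceProb * x.2 * ψ x.2 := by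
  simp [pushedMean, h1, h2]

theorem pushedMean_of_not_push (ψ : ℕ → ℝ) {x : ℝ × ℕ} (h : ¬ (x.2 < p.Cthr ∧ p.Ep ≤ x.1)) :
    p.pushedMean ψ x = (1 - p.replaceProb * x.2) * ψ x.2 + p.replaceProb * x.2 * ψ (x.2 - 1) := by
  simp [pushedMean, h]

theorem contentValue_of_lt {c : ℕ} (h : c < p.Cthr) :
    p.contentValue d c = -(max (p.pushValue d) 0 * ((p.Cthr : ℝ) - 1 - c)) := by
  rw [contentValue, if_neg (not_le.2 h), Nat.cast_sub (by omega), Nat.cast_sub (by omega)]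
  simp

theorem contentValue_of_ge {c : ℕ} (h : p.Cthr ≤ c) (hc : c ≤ p.N) :
    p.contentValue d c = p.pushValue d - p.Eu d / p.replaceProb * ((c : ℝ) - p.Cthr) := by
  rw [contentValue, if_pos h, min_eq_left hc, Nat.cast_sub h]

/-- Above the threshold, `contentValue` falls by `Eu d / q` per extra content. A removal has
probability at least `q`, so its mean gain of value pays for any unicast. -/
theorem Valid.surplus_nonneg_of_gt (hp : p.Valid) [IsProbabilityMeasure ν] (hd : 0 ≤ d)
    (hdem : 0 ≤ p.demand d) {x : ℝ × ℕ} (hN : x.2 ≤ p.N) (h : p.Cthr < x.2) :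
    0 ≤ p.surplus ν d x := by
  have hU := hp.integral_energyUsed_of_ge (ν := ν) hd h.le
  have hq := hp.replaceProb_pos
  have hE := hp.Eu_nonneg hd
  have hc1 : (1 : ℝ) ≤ x.2 := by exact_mod_cast (by omega : 1 ≤ x.2)
  have h1 : p.replaceProb * x.2 * (p.Eu d / p.replaceProb) = x.2 * p.Eu d := by field_simp
  rw [surplus, pushedMean_of_not_push _ (fun h' => by omega), contentValue_of_ge h.le hN,
    contentValue_of_ge (by omega : p.Cthr ≤ x.2 - 1) (by omega), Nat.cast_sub (by omega),
    Nat.cast_one]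
  nlinarith

/-- The mean loss of content value is the second summand of `demand`, so the plentiful regime
balances exactly and only the undelivered energy is left. -/
theorem Valid.surplus_of_eq (hp : p.Valid) [IsProbabilityMeasure ν] (hd : 0 ≤ d) (hdR : d ≤ p.R)
    {x : ℝ × ℕ} (h : x.2 = p.Cthr) :
    p.surplus ν d x = p.lostEnergy ν d x.1 := by
  rw [surplus, pushedMean_of_not_push _ (fun h' => by omega),
    hp.integral_energyUsed_of_eq hd hdR h, h, contentValue_of_ge le_rfl p.Cthr_le_N, demand]
  rcases Nat.eq_zero_or_pos p.Cthr with h2 | h2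
  · rw [h2]
    simp
  · rw [contentValue_of_lt (by omega : p.Cthr - 1 < p.Cthr), Nat.cast_sub h2]
    simp
    ring

theorem surplus_of_starved {x : ℝ × ℕ} (h : x.2 < p.Cthr)
    (hE : x.1 < p.Ep) :
    p.surplus ν d x = p.demand d - p.replaceProb * x.2 * max (p.pushValue d) 0 := by
  rw [surplus, pushedMean_of_not_push _ (fun h' => not_le.2 hE h'.2),
    integral_energyUsed_of_starved h hE, contentValue_of_lt h]
  rcases Nat.eq_zero_or_pos x.2 with h2 | h2
  · rw [h2]
    simp
  · rw [contentValue_of_lt (by omega : x.2 - 1 < p.Cthr), Nat.cast_sub h2]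
    push_cast
    ring

theorem Valid.surplus_nonneg_of_push (hp : p.Valid) [IsProbabilityMeasure ν] {x : ℝ × ℕ}
    (h : x.2 < p.Cthr) (hE : p.Ep ≤ x.1) : 0 ≤ p.surplus ν d x := by
  have hNC := p.Cthr_le_N
  have hq := hp.replaceProb_pos
  have hqc := hp.replaceProb_mul_le_one (c := x.2) (by omega)
  have hm := le_max_left (p.pushValue d) 0
  have hm0 := le_max_right (p.pushValue d) 0
  rw [surplus, pushedMean_of_push _ h hE, hp.integral_energyUsed_of_push h hE,
    contentValue_of_lt h, hp.demand_eq]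
  rcases Nat.lt_or_ge (x.2 + 1) p.Cthr with h2 | h2
  · rw [contentValue_of_lt h2]
    push_cast
    have hc : (x.2 : ℝ) + 1 + 1 ≤ p.Cthr := by exact_mod_cast h2
    have hq1 := hp.replaceProb_mul_le_one (c := p.Cthr - 1) (by omega)
    rw [Nat.cast_sub (by omega), Nat.cast_one] at hq1
    -- With `m = max (pushValue d) 0` the surplus is `(1 - q * (Cthr - 1)) * (m - pushValue d) + q *
    -- (Cthr - 1 - x.2) * m`, a sum of two nonnegative terms.
    nlinarith [mul_nonneg (sub_nonneg.2 hq1) (sub_nonneg.2 hm),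
      mul_nonneg (mul_nonneg hq.le (by linarith : (0 : ℝ) ≤ p.Cthr - 1 - x.2)) hm0]
  -- At `Cthr - 1` the push leads to the threshold and the energy balance is exact: the surplus is
  -- zero.
  · rw [contentValue_of_ge h2 (by omega)]
    have hc : (p.Cthr : ℝ) = x.2 + 1 := by exact_mod_cast (by omega : p.Cthr = x.2 + 1)
    rw [hc]
    push_cast
    apply le_of_eq
    ring

/-! ### Blocking -/

theorem blocked_of_ge_iff {x : ℝ × ℕ} {s : Slot} (h : p.Cthr ≤ x.2) :
    p.Blocked d x s ↔ 0 < p.Q x.2 s ∧ ¬ (p.Q x.2 s ≤ p.Eu d ∧ p.Q x.2 s ≤ x.1) := by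
  rw [Blocked, Ne, act_eq_unicast_iff, act_eq_push_iff]
  have : ¬ x.2 < p.Cthr := not_lt.2 h
  tauto

theorem blocked_of_push_iff {x : ℝ × ℕ} {s : Slot} (h : x.2 < p.Cthr) (hE : p.Ep ≤ x.1) :
    p.Blocked d x s ↔ 0 < p.Q x.2 s ∧ s.rank ≠ x.2 + 1 := by
  rw [Blocked, Ne, act_eq_unicast_iff, act_eq_push_iff]
  tauto

theorem Valid.blockProb_eq_integral (hp : p.Valid) (ν : Measure ℝ) (d : ℝ) (x : ℝ × ℕ) :
    p.blockProb ν d x = ∫ s, {s | p.Blocked d x s}.indicator (fun _ => (1 : ℝ)) s ∂p.slotLaw ν := by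
  have : MeasurableSet {s | p.Blocked d x s} := measurable_prodMk_left (hp.measurableSet_blocked d)
  rw [integral_indicator_const _ this]
  simp [blockProb]

/-- The requested content of rank `x.2 + 1 = Cthr` is being pushed, so exactly the ranks above
`Cthr` are blocked. Requests from the origin have `Q = 0` but form a null set. -/
theorem Valid.blockProb_of_push (hp : p.Valid) [IsProbabilityMeasure ν] {x : ℝ × ℕ}
    (h : x.2 + 1 = p.Cthr) (hE : p.Ep ≤ x.1) : p.blockProb ν d x = p.pu * p.tail p.Cthr := by
  have := hp.isProbabilityMeasure_locationLaw
  have h1 := hp.integral_request_tail ν (p.Cthr_le_N)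
    (fun z => 1 - if ‖z‖ ≤ 0 then (1 : ℝ) else 0)
  have hi : Integrable (fun z : EuclideanSpace ℝ (Fin 2) => if ‖z‖ ≤ 0 then (1 : ℝ) else 0)
      p.locationLaw := by
    refine Integrable.of_bound (Measurable.ite (measurableSet_le measurable_norm measurable_const)
      measurable_const measurable_const).aestronglyMeasurable 1 (ae_of_all _ fun z => ?_)
    split_ifs <;> simp
  rw [integral_sub (integrable_const _) hi, hp.integral_indicator_locationLaw le_rfl hp.R_pos.le]
    at h1
  have h2 : p.blockProb ν d x = p.pu * p.tail p.Cthr * (1 - 0 ^ 2 / p.R ^ 2) := by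
    rw [hp.blockProb_eq_integral]
    simp only [integral_const, probReal_univ, smul_eq_mul, mul_one] at h1
    rw [← h1]
    refine integral_congr_ae (ae_of_all _ fun s => ?_)
    have hE0 := hp.Eu_pos (norm_nonneg s.location)
    simp only [Set.indicator, Set.mem_ofPred_eq, blocked_of_push_iff (d := d) (s := s)
      (by omega : x.2 < p.Cthr) hE, Q]
    by_cases hr : s.request = true ∧ x.2 < s.rank
    · by_cases hs : s.rank = x.2 + 1
      · have : ¬ p.Cthr < x.2 + 1 := by omega
        simp only [hs, this, and_false, if_false, ne_eq, not_true_eq_false]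
      · have : p.Cthr < s.rank := by omega
        by_cases hz : 0 < ‖s.location‖
        · simp only [hr, and_self, if_true, hE0, hz, hs, ne_eq, not_false_eq_true, this,
            not_le.2 hz, if_false, sub_zero]
        · have hz0 : s.location = 0 := by simpa using hz
          simp [hr, hz0, hp.Eu_zero]
    · have : ¬ (s.request = true ∧ p.Cthr < s.rank) := fun h' => hr ⟨h'.1, by omega⟩
      simp only [hr, this, if_false, lt_irrefl, false_and]
  rw [h2]
  simp

/-- Only requests from within `d` that exceed the stored energy are blocked additionally. Those from
within `r` have small probability; beyond `r` each loses at least `Eu r`, so Markov's inequality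
bounds them by the lost energy. -/
theorem Valid.blockProb_of_eq (hp : p.Valid) [IsProbabilityMeasure ν] (hd : 0 ≤ d) (hdR : d ≤ p.R)
    {r : ℝ} (hr : 0 < r) (hrR : r ≤ p.R) {x : ℝ × ℕ} (h : x.2 = p.Cthr) :
    |p.blockProb ν d x - p.pu * p.tail p.Cthr * (1 - d ^ 2 / p.R ^ 2)|
      ≤ r ^ 2 / p.R ^ 2 + p.lostEnergy ν d x.1 / p.Eu r := by
  have := hp.isProbabilityMeasure_locationLaw
  have := hp.isProbabilityMeasure_slotLaw ν
  have hEr := (hp.Eu_pos hr.le).2 hr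
  have hmb : ∀ t : ℝ, Measurable fun z : EuclideanSpace ℝ (Fin 2) => if ‖z‖ ≤ t then (1 : ℝ) else 0 :=
    fun t => Measurable.ite (measurableSet_le measurable_norm measurable_const)
      measurable_const measurable_const
  have hib : ∀ t : ℝ, Integrable (fun z : EuclideanSpace ℝ (Fin 2) => if ‖z‖ ≤ t then (1 : ℝ) else 0)
      p.locationLaw := fun t => by
    refine Integrable.of_bound (hmb t).aestronglyMeasurable 1 (ae_of_all _ fun z => ?_)
    split_ifs <;> simp
  have h1 := hp.integral_request_tail ν (p.Cthr_le_N) (fun z => 1 - if ‖z‖ ≤ d then (1 : ℝ) else 0)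
  rw [integral_sub (integrable_const _) (hib d), hp.integral_indicator_locationLaw hd hdR] at h1
  simp only [integral_const, probReal_univ, smul_eq_mul, mul_one] at h1
  have h2 := hp.integral_request_tail ν (p.Cthr_le_N) (fun z => if ‖z‖ ≤ r then (1 : ℝ) else 0)
  rw [hp.integral_indicator_locationLaw hr.le hrR] at h2
  have hi1 : Integrable (fun s : Slot => if s.request = true ∧ p.Cthr < s.rank then
      1 - (if ‖s.location‖ ≤ d then (1 : ℝ) else 0) else 0) (p.slotLaw ν) := by
    refine Integrable.of_bound (measurable_ite_request p.Cthr
      (measurable_const.sub (hmb d))).aestronglyMeasurable 1 (ae_of_all _ fun s => ?_)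
    split_ifs <;> simp
  have hi2 : Integrable (fun s : Slot => if s.request = true ∧ p.Cthr < s.rank then
      (if ‖s.location‖ ≤ r then (1 : ℝ) else 0) else 0) (p.slotLaw ν) := by
    refine Integrable.of_bound (measurable_ite_request p.Cthr
      (hmb r)).aestronglyMeasurable 1 (ae_of_all _ fun s => ?_)
    split_ifs <;> simp
  have hi3 := (hp.integrable_lost (ν := ν) hd x.1).div_const (p.Eu r)
  have hib : Integrable ({s | p.Blocked d x s}.indicator (fun _ => (1 : ℝ))) (p.slotLaw ν) :=
    (integrable_const _).indicator (measurable_prodMk_left (hp.measurableSet_blocked d))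
  have key : ∀ s : Slot,
      (if s.request = true ∧ p.Cthr < s.rank then
        1 - (if ‖s.location‖ ≤ d then (1 : ℝ) else 0) else 0)
        ≤ {s | p.Blocked d x s}.indicator (fun _ => (1 : ℝ)) s ∧
      {s | p.Blocked d x s}.indicator (fun _ => (1 : ℝ)) s ≤
      (if s.request = true ∧ p.Cthr < s.rank then
        1 - (if ‖s.location‖ ≤ d then (1 : ℝ) else 0) else 0)
      + ((if s.request = true ∧ p.Cthr < s.rank then
        (if ‖s.location‖ ≤ r then (1 : ℝ) else 0) else 0)
      + (if s.request = true ∧ p.Cthr < s.rank then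
      (if p.Eu ‖s.location‖ ≤ p.Eu d ∧ x.1 < p.Eu ‖s.location‖ then p.Eu ‖s.location‖ else 0)
      else 0) / p.Eu r) := by
    intro s
    have hE0 := hp.Eu_pos (norm_nonneg s.location)
    have hEd := hp.Eu_le_Eu (norm_nonneg s.location) hd
    have hErz := hp.Eu_lt_Eu hr.le (norm_nonneg s.location)
    simp only [Set.indicator, Set.mem_ofPred_eq, blocked_of_ge_iff (d := d) (s := s) h.ge, Q, h]
    by_cases hreq : s.request = true ∧ p.Cthr < s.rank
    · simp only [hreq, and_self, if_true]
      simp only [hE0, hEd]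
      by_cases ha : ‖s.location‖ ≤ d
      · by_cases hb : p.Eu ‖s.location‖ ≤ x.1
        · simp only [ha, hb, not_true_eq_false, and_false, if_false, if_true, sub_self, le_refl,
            not_lt.2 hb, zero_div, add_zero, zero_add, true_and, and_self]
          split_ifs <;> norm_num
        · by_cases hc : ‖s.location‖ ≤ r
          · have := div_nonneg (hp.Eu_nonneg (norm_nonneg s.location)) hEr.le
            simp only [ha, hb, hc, not_le.1 hb, and_false, not_false_eq_true, and_true, if_true,
              sub_self, zero_add]
            split_ifs <;> constructor <;> linarith
          · have : 1 ≤ p.Eu ‖s.location‖ / p.Eu r := by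
              rw [one_le_div hEr]
              exact (hErz.2 (not_le.1 hc)).le
            simp only [ha, hb, hc, not_le.1 hb, and_false, not_false_eq_true, and_true, if_true,
              sub_self, zero_add, if_false]
            split_ifs <;> constructor <;> linarith
      · have hz : 0 < ‖s.location‖ := lt_of_le_of_lt hd (not_le.1 ha)
        simp only [ha, hz, false_and, not_false_eq_true, and_self, if_true, if_false, sub_zero,
          le_refl, zero_div, add_zero, true_and]
        split_ifs <;> norm_num
    · simp [hreq]
  have hlow := integral_mono hi1 hib fun s => (key s).1
  have hup := integral_mono hib (hi1.add (hi2.add hi3)) fun s => (key s).2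
  rw [integral_add' hi1 (hi2.add hi3), integral_add' hi2 hi3, integral_div] at hup
  rw [← hp.blockProb_eq_integral, h1] at hlow hup
  rw [h2] at hup
  have hpt : p.pu * p.tail p.Cthr ≤ 1 :=
    mul_le_one₀ hp.pu_le_one (hp.tail_nonneg p.Cthr_le_N) (hp.tail_le_one _)
  have hrr : 0 ≤ r ^ 2 / p.R ^ 2 := by positivity
  have hlost := div_nonneg (hp.lostEnergy_nonneg ν d x.1) hEr.le
  rw [abs_le]
  refine ⟨by linarith, ?_⟩
  have : p.pu * p.tail p.Cthr * (r ^ 2 / p.R ^ 2) ≤ r ^ 2 / p.R ^ 2 :=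
    mul_le_of_le_one_left hrr hpt
  change p.blockProb ν d x ≤ _ + (_ + p.lostEnergy ν d x.1 / p.Eu r) at hup
  linarith

/-- The Poisson equations at `Cthr` and at `Cthr - 1`. The factor `1 + q` in `blockGain` is the sum
of the transition probabilities between these two states. -/
theorem Valid.blockGain_eq (hp : p.Valid) (d : ℝ) :
    p.pu * p.tail p.Cthr * (1 - d ^ 2 / p.R ^ 2) - p.replaceProb * p.Cthr * p.blockGain d
      = p.pblkRadius d ∧
    p.pu * p.tail p.Cthr + (1 - p.replaceProb * (p.Cthr - 1)) * p.blockGain d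
      = p.pblkRadius d := by
  have h1 := hp.N_pos'
  have h2 := hp.pc_pos
  have h3 : (p.N : ℝ) + p.pc ≠ 0 := by positivity
  have h4 : 1 + p.pc / (p.N : ℝ) ≠ 0 := by positivity
  have h5 := hp.R_pos
  constructor <;>
  · rw [blockGain, pblkRadius, pblkLB, η, replaceProb]
    field_simp
    ring

/-- Defect of the Poisson equation for blocking. -/
noncomputable def blockDefect (p : Model) (ν : Measure ℝ) (d : ℝ) (x : ℝ × ℕ) : ℝ :=
  p.blockProb ν d x + (p.pushedMean (p.blockValue d) x - p.blockValue d x.2) - p.pblkRadius d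

theorem Valid.blockDefect_of_push (hp : p.Valid) [IsProbabilityMeasure ν] {x : ℝ × ℕ}
    (h : x.2 + 1 = p.Cthr) (hE : p.Ep ≤ x.1) : p.blockDefect ν d x = 0 := by
  have h1 : ¬ p.Cthr ≤ x.2 := by omega
  have h2 : (p.Cthr : ℝ) = x.2 + 1 := by exact_mod_cast h.symm
  have h3 := (hp.blockGain_eq d).2
  rw [blockDefect, hp.blockProb_of_push h hE, pushedMean_of_push _ (by omega) hE]
  simp only [blockValue, h, le_refl, if_true, h1, if_false]
  rw [← h3, h2]
  ring

theorem Valid.abs_blockDefect_of_eq (hp : p.Valid) [IsProbabilityMeasure ν] (hd : 0 ≤ d)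
    (hdR : d ≤ p.R) {r : ℝ} (hr : 0 < r) (hrR : r ≤ p.R) {x : ℝ × ℕ}
    (h : x.2 = p.Cthr) :
    |p.blockDefect ν d x| ≤ r ^ 2 / p.R ^ 2 + p.lostEnergy ν d x.1 / p.Eu r := by
  have h1 := hp.blockProb_of_eq (ν := ν) hd hdR hr hrR h
  have h3 := (hp.blockGain_eq d).1
  have h4 : p.blockDefect ν d x
      = p.blockProb ν d x - p.pu * p.tail p.Cthr * (1 - d ^ 2 / p.R ^ 2) := by
    rw [blockDefect, pushedMean_of_not_push _ (fun h' => by omega), ← h3, h]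
    rcases Nat.eq_zero_or_pos p.Cthr with h2 | h2
    · simp [h2]
    · have : ¬ p.Cthr ≤ p.Cthr - 1 := by omega
      simp only [blockValue, le_refl, if_true, this, if_false]
      ring
  rwa [h4]

theorem abs_blockValue_le (d : ℝ) (c : ℕ) : |p.blockValue d c| ≤ |p.blockGain d| := by
  unfold blockValue
  split_ifs <;> simp

theorem Valid.abs_blockDefect_le (hp : p.Valid) [IsProbabilityMeasure ν] {x : ℝ × ℕ}
    (hx : x.2 ≤ p.N) :
    |p.blockDefect ν d x| ≤ 1 + 2 * |p.blockGain d| + |p.pblkRadius d| := by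
  have := hp.isProbabilityMeasure_slotLaw ν
  have h1 : p.blockProb ν d x ≤ 1 := measureReal_le_one
  have h2 : 0 ≤ p.blockProb ν d x := measureReal_nonneg
  have h3 := hp.replaceProb_mul_le_one hx
  have h4 : 0 ≤ p.replaceProb * x.2 := mul_nonneg hp.replaceProb_pos.le (Nat.cast_nonneg _)
  have h5 : |p.pushedMean (p.blockValue d) x| ≤ |p.blockGain d| := by
    unfold pushedMean
    refine (abs_add_le _ _).trans ?_
    rw [abs_mul, abs_mul, abs_of_nonneg h4, abs_of_nonneg (sub_nonneg.2 h3)]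
    have h6 := mul_le_mul_of_nonneg_left (p.abs_blockValue_le d
      (x.2 + if x.2 < p.Cthr ∧ p.Ep ≤ x.1 then 1 else 0)) (sub_nonneg.2 h3)
    have h7 := mul_le_mul_of_nonneg_left (p.abs_blockValue_le d
      (x.2 + (if x.2 < p.Cthr ∧ p.Ep ≤ x.1 then 1 else 0) - 1)) h4
    linarith
  have h6 := abs_le.1 h5
  have h7 := abs_le.1 (p.abs_blockValue_le d x.2)
  have h8 := abs_le.1 (le_refl |p.pblkRadius d|)
  unfold blockDefect
  rw [abs_le]
  constructor <;> linarith

end Model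

/-! ### Estimates for the quadratic potential -/

theorem sq_posPart_sub_le (z w : ℝ) :
    max (z - w) 0 ^ 2 / 2 ≤ max z 0 ^ 2 / 2 - max z 0 * w + w ^ 2 / 2 := by
  rcases le_total 0 z with hz | hz
  · rw [max_eq_left hz]
    rcases le_total 0 (z - w) with h | h
    · rw [max_eq_left h]
      nlinarith
    · rw [max_eq_right h]
      nlinarith [sq_nonneg (z - w)]
  · rw [max_eq_right hz]
    rcases le_total 0 (z - w) with h | h
    · rw [max_eq_left h]
      nlinarith
    · rw [max_eq_right h]
      nlinarith [sq_nonneg w]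

/-- A quadratic potential needs bounded steps, while the harvest has only a finite mean. Truncation
at a high level loses arbitrarily little mean. -/
theorem exists_le_integral_min {ν : Measure ℝ} (hν : Integrable (fun a : ℝ => a) ν) {τ : ℝ}
    (hτ : 0 < τ) : ∃ T : ℝ, 0 ≤ T ∧ ∫ a, a ∂ν - τ ≤ ∫ a, min a T ∂ν := by
  have h : Tendsto (fun n : ℕ => ∫ a, min a (n : ℝ) ∂ν) atTop (𝓝 (∫ a, a ∂ν)) := by
    refine tendsto_integral_of_dominated_convergence (fun a => |a|)
      (fun n => (measurable_id.min measurable_const).aestronglyMeasurable) hν.abs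
      (fun n => ae_of_all _ fun a => ?_) (ae_of_all _ fun a => ?_)
    · rw [Real.norm_eq_abs]
      rcases le_total a n with h | h
      · rw [min_eq_left h]
      · have hn : (0 : ℝ) ≤ n := Nat.cast_nonneg n
        rw [min_eq_right h, abs_of_nonneg hn, abs_of_nonneg (hn.trans h)]
        exact h
    · refine tendsto_const_nhds.congr' ?_
      obtain ⟨m, hm⟩ := exists_nat_ge a
      filter_upwards [eventually_ge_atTop m] with n hn
      rw [min_eq_left (hm.trans (by exact_mod_cast hn))]
  obtain ⟨n, hn⟩ := (h.eventually (eventually_gt_nhds (by linarith :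
    ∫ a, a ∂ν - τ < ∫ a, a ∂ν))).exists
  exact ⟨n, Nat.cast_nonneg n, hn.le⟩

theorem toReal_min_coe_eq_or {B : EReal} {b : ℝ} (hB : (b : EReal) ≤ B) (y : ℝ) :
    (min B (y : EReal)).toReal = y ∨ b ≤ (min B (y : EReal)).toReal ∧ b ≤ y := by
  induction B with
  | bot => simp at hB
  | top => left; simp
  | coe B =>
    have hB' : b ≤ B := by exact_mod_cast hB
    rcases le_total y B with h | h
    · left
      rw [min_eq_right (by exact_mod_cast h), EReal.toReal_coe]
    · right
      rw [min_eq_left (by exact_mod_cast h), EReal.toReal_coe]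
      exact ⟨hB', hB'.trans h⟩

/-- The truncation loss is amplified by the depth `y ≤ 2 * Y`, and the second-order term is `M`;
after scaling by `K / Y` each contributes at most `ε / 4`. -/
theorem scaled_drift_le {K Y y e a M I ε : ℝ} (hK : 0 < K) (hY : 0 < Y) (hε : 0 < ε) (hy0 : 0 ≤ y)
    (hyY : y ≤ 2 * Y) (ha : -(ε / (8 * K)) ≤ a) (hM : 4 * K * M / ε ≤ Y)
    (hI : I ≤ -(y * (a + e)) + M) : K / Y * I ≤ ε / 2 - K / Y * (y * e) := by
  have hτ : 0 < ε / (8 * K) := by positivity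
  have h1 : -(y * a) ≤ 2 * Y * (ε / (8 * K)) := by nlinarith
  have h2 : K / Y * (2 * Y * (ε / (8 * K))) = ε / 4 := by
    field_simp
    norm_num
  have h3 : K / Y * M ≤ ε / 4 := by
    rw [div_le_iff₀ hε] at hM
    rw [div_mul_eq_mul_div, div_le_iff₀ hY]
    linarith
  have h4 : I ≤ -(y * e) + (2 * Y * (ε / (8 * K)) + M) := by linarith
  have h5 := mul_le_mul_of_nonneg_left h4 (div_pos hK hY).le
  linarith

theorem mul_le_div_mul_mul {K Y y e : ℝ} (hK : 0 ≤ K) (hY : 0 < Y) (hy : Y ≤ y) (he : 0 ≤ e) :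
    K * e ≤ K / Y * (y * e) := by
  calc K * e = K / Y * (Y * e) := by field_simp
    _ ≤ K / Y * (y * e) := by gcongr

/-! ### Drift of the shortfall -/

namespace Model

/-- Squared shortfall of stored energy plus content value below the level `b`. -/
noncomputable def shortfall (p : Model) (d b : ℝ) (x : ℝ × ℕ) : ℝ :=
  max (b - (max x.1 0 + p.contentValue d x.2)) 0 ^ 2 / 2

variable {p : Model} {ν : Measure ℝ} {d b T : ℝ} {B : EReal}

/-- Discarding harvest beyond `T` can only deepen the shortfall, and makes the step bounded. The
margin `valueBound` in the capacity makes overflow harmless. -/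
theorem Valid.shortfall_step_le (hp : p.Valid) (hd : 0 ≤ d) (hT : 0 ≤ T)
    (hB : ((b + p.valueBound d : ℝ) : EReal) ≤ B) {x : ℝ × ℕ} (hx : 0 ≤ x.1) {s : Slot}
    (hs : 0 ≤ s.harvest) :
    p.shortfall d b (p.step B d x s) ≤ p.shortfall d b x
      - max (b - (x.1 + p.contentValue d x.2)) 0 * (min s.harvest T
        - p.energyUsed (p.Q x.2 s) (p.act d x s)
        + (p.contentValue d (p.step B d x s).2 - p.contentValue d x.2))
      + (T + (p.Ep + p.Eu d) + 2 * p.valueBound d) ^ 2 / 2 := by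
  have hU0 := hp.energyUsed_nonneg d x s
  have hU := hp.energyUsed_le hd x s
  have hUx := energyUsed_le_energy (p := p) d hx s
  have hG0 := hp.valueBound_nonneg hd
  have hg := abs_le.1 (hp.abs_contentValue_le hd x.2)
  have hg' := abs_le.1 (hp.abs_contentValue_le hd (p.step B d x s).2)
  have hm0 : 0 ≤ min s.harvest T := le_min hs hT
  have hmT : min s.harvest T ≤ T := min_le_right _ _
  have hmh : min s.harvest T ≤ s.harvest := min_le_left _ _
  have hfst : (p.step B d x s).1 = (min B ((x.1 - p.energyUsed (p.Q x.2 s) (p.act d x s)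
    + s.harvest : ℝ) : EReal)).toReal := rfl
  set U := p.energyUsed (p.Q x.2 s) (p.act d x s) with hUdef
  set g' := p.contentValue d (p.step B d x s).2 with hg'def
  set g := p.contentValue d x.2
  set G := p.valueBound d
  set w := min s.harvest T - U + (g' - g) with hw
  have h1 : p.shortfall d b (p.step B d x s) ≤ max (b - (x.1 + g) - w) 0 ^ 2 / 2 := by
    have : max (b - (max (p.step B d x s).1 0 + g')) 0 ≤ max (b - (x.1 + g) - w) 0 := by
      -- Either the battery does not overflow, or it ends at least at `b + G`, where the shortfall
      -- is zero whatever the content value.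
      rcases toReal_min_coe_eq_or hB (x.1 - U + s.harvest) with h | ⟨h, -⟩
      · rw [hfst, h, max_eq_left (show 0 ≤ x.1 - U + s.harvest by linarith)]
        exact max_le_max (by linarith) le_rfl
      · rw [← hfst] at h
        refine max_le ?_ (le_max_right _ _)
        refine le_trans ?_ (le_max_right _ _)
        have := le_max_left (p.step B d x s).1 0
        linarith
    unfold shortfall
    gcongr
  have h2 := sq_posPart_sub_le (b - (x.1 + g)) w
  have h3 : w ^ 2 ≤ (T + (p.Ep + p.Eu d) + 2 * G) ^ 2 :=
    sq_le_sq' (by linarith) (by linarith)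
  have h4 : p.shortfall d b x = max (b - (x.1 + g)) 0 ^ 2 / 2 := by
    rw [shortfall, max_eq_left hx]
  linarith

theorem measurable_shortfall : Measurable (p.shortfall d b) := by
  have h : Measurable fun x : ℝ × ℕ => p.contentValue d x.2 :=
    (measurable_from_nat (f := p.contentValue d)).comp measurable_snd
  exact (((measurable_const.sub ((measurable_fst.max measurable_const).add h)).max
    measurable_const).pow_const 2).div_const 2

theorem shortfall_nonneg (x : ℝ × ℕ) : 0 ≤ p.shortfall d b x := by
  unfold shortfall
  positivity

/-- The truncation of the energy at zero in `shortfall` yields a bound on the whole state space, as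
the drift criterion requires. -/
theorem Valid.shortfall_le (hp : p.Valid) (hd : 0 ≤ d) (hb : 0 ≤ b) (x : ℝ × ℕ) :
    p.shortfall d b x ≤ (b + p.valueBound d) ^ 2 / 2 := by
  have hG0 := hp.valueBound_nonneg hd
  have hg := abs_le.1 (hp.abs_contentValue_le hd x.2)
  have := le_max_right x.1 0
  unfold shortfall
  gcongr
  exact max_le (by linarith) (by linarith)

theorem Valid.integrable_shortfall_step (hp : p.Valid) [IsProbabilityMeasure ν] (hd : 0 ≤ d)
    (hb : 0 ≤ b) (B : EReal) (x : ℝ × ℕ) :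
    Integrable (fun s => p.shortfall d b (p.step B d x s)) (p.slotLaw ν) := by
  have := hp.isProbabilityMeasure_slotLaw ν
  refine Integrable.of_bound (measurable_shortfall.comp (measurable_slot_of_pair
    (hp.measurable_step B d) x)).aestronglyMeasurable ((b + p.valueBound d) ^ 2 / 2)
    (ae_of_all _ fun s => ?_)
  rw [Real.norm_eq_abs, abs_of_nonneg (shortfall_nonneg _)]
  exact hp.shortfall_le hd hb _

theorem Valid.integrable_step_snd (hp : p.Valid) [IsProbabilityMeasure ν] {ψ : ℕ → ℝ} {a : ℝ}
    (hψ : ∀ c, |ψ c| ≤ a) (B : EReal) (d : ℝ) (x : ℝ × ℕ) :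
    Integrable (fun s => ψ (p.step B d x s).2) (p.slotLaw ν) := by
  have := hp.isProbabilityMeasure_slotLaw ν
  exact Integrable.of_bound ((measurable_from_nat (f := ψ)).comp
    (hp.measurable_step_snd B d x)).aestronglyMeasurable a
    (ae_of_all _ fun s => by simpa using hψ _)

theorem ae_slotLaw_harvest_nonneg (hp : p.Valid) [IsProbabilityMeasure ν]
    (hν : ∀ᵐ a ∂ν, 0 ≤ a) : ∀ᵐ s ∂p.slotLaw ν, 0 ≤ s.harvest := by
  have := isProbabilityMeasure_bernoulliLaw hp.pu_nonneg hp.pu_le_one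
  have := isProbabilityMeasure_bernoulliLaw hp.pc_pos.le hp.pc_le_one
  have := hp.isProbabilityMeasure_rankLaw
  have := hp.isProbabilityMeasure_replacedLaw
  have := hp.isProbabilityMeasure_locationLaw
  exact Measure.quasiMeasurePreserving_fst.ae hν

theorem Valid.integral_shortfall_step_le (hp : p.Valid) [IsProbabilityMeasure ν]
    (hν : ∀ᵐ a ∂ν, 0 ≤ a) (hd : 0 ≤ d) (hb : 0 ≤ b) (hT : 0 ≤ T)
    (hB : ((b + p.valueBound d : ℝ) : EReal) ≤ B) {x : ℝ × ℕ} (hx : 0 ≤ x.1) (hN : x.2 ≤ p.N) :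
    ∫ s, p.shortfall d b (p.step B d x s) ∂p.slotLaw ν ≤ p.shortfall d b x
      - max (b - (x.1 + p.contentValue d x.2)) 0 *
        (∫ a, min a T ∂ν - p.demand d + p.surplus ν d x)
      + (T + (p.Ep + p.Eu d) + 2 * p.valueBound d) ^ 2 / 2 := by
  have := hp.isProbabilityMeasure_slotLaw ν
  have hae := ae_slotLaw_harvest_nonneg hp hν
  have hi1 : Integrable (fun s : Slot => min s.harvest T) (p.slotLaw ν) := by
    refine Integrable.of_bound (measurable_harvest.min measurable_const).aestronglyMeasurable T ?_
    filter_upwards [hae] with s hs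
    rw [Real.norm_eq_abs, abs_of_nonneg (le_min hs hT)]
    exact min_le_right _ _
  have hi2 := hp.integrable_energyUsed (ν := ν) hd x
  have hi3 := hp.integrable_step_snd (ν := ν) (hp.abs_contentValue_le hd) B d x
  have hi4 := hi3.sub (integrable_const (p.contentValue d x.2))
  have hi5 := ((hi1.sub hi2).add hi4).const_mul (max (b - (x.1 + p.contentValue d x.2)) 0)
  have hi6 := ((integrable_const (μ := p.slotLaw ν) (p.shortfall d b x)).sub hi5).add
    (integrable_const ((T + (p.Ep + p.Eu d) + 2 * p.valueBound d) ^ 2 / 2))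
  refine (integral_mono_ae (hp.integrable_shortfall_step hd hb B x) hi6 ?_).trans (le_of_eq ?_)
  · filter_upwards [hae] with s hs
    exact hp.shortfall_step_le hd hT hB hx hs
  · rw [integral_add' ((integrable_const _).sub hi5) (integrable_const _),
      integral_sub' (integrable_const _) hi5, integral_const_mul,
      integral_add' (hi1.sub hi2) hi4, integral_sub' hi1 hi2, integral_sub' hi3 (integrable_const _),
      hp.integral_step_snd B d _ hN, hp.integral_harvest ν (fun a => min a T), surplus]
    simp only [integral_const, probReal_univ, smul_eq_mul, one_mul]
    ring

/-! ### Drift of the content count and the test function -/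

/-- Number of pushed contents in excess of the threshold. -/
noncomputable def excess (p : Model) (c : ℕ) : ℝ := ((min c p.N - p.Cthr : ℕ) : ℝ)

/-- Number of contents missing to one less than the threshold. -/
noncomputable def deficit (p : Model) (c : ℕ) : ℝ := ((p.Cthr - 1 - c : ℕ) : ℝ)

theorem abs_excess_le (c : ℕ) : |p.excess c| ≤ p.N := by
  rw [excess, abs_of_nonneg (Nat.cast_nonneg _)]
  exact_mod_cast (Nat.sub_le _ _).trans (min_le_right _ _)

theorem abs_deficit_le (c : ℕ) : |p.deficit c| ≤ p.N := by
  have := p.Cthr_le_N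
  rw [deficit, abs_of_nonneg (Nat.cast_nonneg _)]
  exact_mod_cast (by omega : p.Cthr - 1 - c ≤ p.N)

theorem pushedMean_const_of_eq {ψ : ℕ → ℝ} {x : ℝ × ℕ} {a : ℝ} (hx : ψ x.2 = a)
    (h1 : ψ (x.2 + if x.2 < p.Cthr ∧ p.Ep ≤ x.1 then 1 else 0) = a)
    (h2 : ψ (x.2 + (if x.2 < p.Cthr ∧ p.Ep ≤ x.1 then 1 else 0) - 1) = a) :
    p.pushedMean ψ x - ψ x.2 = 0 := by
  rw [pushedMean, h1, h2, hx]
  ring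

theorem excess_eq_zero {c : ℕ} (h : c ≤ p.Cthr) : p.excess c = 0 := by
  rw [excess, Nat.sub_eq_zero_of_le ((min_le_left _ _).trans h), Nat.cast_zero]

theorem deficit_eq_zero {c : ℕ} (h : p.Cthr ≤ c + 1) : p.deficit c = 0 := by
  rw [deficit, show p.Cthr - 1 - c = 0 by omega, Nat.cast_zero]

theorem excess_drift_of_le {x : ℝ × ℕ} (h : x.2 ≤ p.Cthr) :
    p.pushedMean p.excess x - p.excess x.2 = 0 := by
  refine pushedMean_const_of_eq (a := 0) (excess_eq_zero h) (excess_eq_zero ?_) (excess_eq_zero ?_)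
  · split_ifs <;> omega
  · split_ifs <;> omega

theorem Valid.excess_drift_of_gt (hp : p.Valid) {x : ℝ × ℕ} (h : p.Cthr < x.2) (hN : x.2 ≤ p.N) :
    p.pushedMean p.excess x - p.excess x.2 ≤ -p.replaceProb := by
  have hq := hp.replaceProb_pos
  have hc1 : (1 : ℝ) ≤ x.2 := by exact_mod_cast (by omega : 1 ≤ x.2)
  rw [pushedMean_of_not_push _ (fun h' => by omega), excess, excess, min_eq_left hN,
    min_eq_left (by omega : x.2 - 1 ≤ p.N), Nat.cast_sub h.le,
    Nat.cast_sub (by omega : p.Cthr ≤ x.2 - 1), Nat.cast_sub (by omega : 1 ≤ x.2), Nat.cast_one]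
  nlinarith

theorem deficit_drift_of_ge {x : ℝ × ℕ} (h : p.Cthr ≤ x.2) :
    p.pushedMean p.deficit x - p.deficit x.2 = 0 := by
  refine pushedMean_const_of_eq (a := 0) (deficit_eq_zero (by omega)) (deficit_eq_zero ?_)
    (deficit_eq_zero ?_)
  · split_ifs <;> omega
  · split_ifs <;> omega

theorem deficit_drift_of_push_eq {x : ℝ × ℕ} (h : x.2 + 1 = p.Cthr) (hE : p.Ep ≤ x.1) :
    p.pushedMean p.deficit x - p.deficit x.2 = 0 := by
  rw [pushedMean_of_push _ (by omega) hE, deficit_eq_zero h.ge, deficit_eq_zero (by omega)]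
  ring

/-- A push lowers the deficit by one unless a removal cancels it. The removal probability is largest
at `N - 1` contents, where it is still below one. -/
theorem Valid.deficit_drift_of_push_lt (hp : p.Valid) {x : ℝ × ℕ} (h : x.2 + 1 < p.Cthr)
    (hE : p.Ep ≤ x.1) :
    p.pushedMean p.deficit x - p.deficit x.2 ≤ -(1 - p.replaceProb * ((p.N - 1 : ℕ) : ℝ)) := by
  have hN := p.Cthr_le_N
  have hq := hp.replaceProb_pos
  have hc : (x.2 : ℝ) ≤ ((p.N - 1 : ℕ) : ℝ) := by exact_mod_cast (by omega : x.2 ≤ p.N - 1)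
  have hd : p.deficit x.2 = p.deficit (x.2 + 1) + 1 := by
    rw [deficit, deficit, show p.Cthr - 1 - x.2 = p.Cthr - 1 - (x.2 + 1) + 1 by omega]
    push_cast
    ring
  rw [pushedMean_of_push _ (by omega) hE, hd]
  nlinarith

theorem Valid.deficit_drift_of_starved (hp : p.Valid) {x : ℝ × ℕ} (h : x.2 < p.Cthr)
    (hE : x.1 < p.Ep) : p.pushedMean p.deficit x - p.deficit x.2 ≤ 1 := by
  have hN := p.Cthr_le_N
  have hq := hp.replaceProb_pos
  have hq1 := hp.replaceProb_mul_le_one (c := x.2) (by omega)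
  have hq0 : 0 ≤ p.replaceProb * x.2 := mul_nonneg hq.le (Nat.cast_nonneg _)
  have hd : p.deficit (x.2 - 1) ≤ p.deficit x.2 + 1 := by
    rw [deficit, deficit]
    exact_mod_cast (by omega : p.Cthr - 1 - (x.2 - 1) ≤ p.Cthr - 1 - x.2 + 1)
  rw [pushedMean_of_not_push _ (fun h' => not_le.2 hE h'.2)]
  nlinarith

/-- A test function whose mean change dominates the defect of the Poisson equation for blocking up
to `ε`, provided the battery is large. -/
theorem Valid.exists_test_function (hp : p.Valid) [IsProbabilityMeasure ν]
    (hν : ∀ᵐ a ∂ν, 0 ≤ a) (hνi : Integrable (fun a : ℝ => a) ν) (hd : 0 ≤ d) (hdR : d ≤ p.R)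
    (hdem0 : 0 ≤ p.demand d) (hdem : p.demand d ≤ ∫ a, a ∂ν) {ε : ℝ} (hε : 0 < ε) :
    ∃ B₀ : ℝ, 0 ≤ B₀ ∧ ∃ Ψ : ℝ × ℕ → ℝ, Measurable Ψ ∧ (∃ a, ∀ x, |Ψ x| ≤ a) ∧
      ∀ B : EReal, (B₀ : EReal) ≤ B → ∀ x : ℝ × ℕ, 0 ≤ x.1 → x.2 ≤ p.N →
        |p.blockDefect ν d x| + (∫ s, Ψ (p.step B d x s) ∂p.slotLaw ν - Ψ x) ≤ ε := by
  obtain ⟨δ, hδ, hgap⟩ := hp.exists_demand_gap hd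
  have hR := hp.R_pos
  have hq := hp.replaceProb_pos
  have hEp := hp.Ep_pos
  have hG := hp.valueBound_nonneg hd
  have hEd := hp.Eu_nonneg hd
  set G := p.valueBound d
  set K := 1 + 2 * |p.blockGain d| + |p.pblkRadius d| with hK
  have hK0 : 0 < K := by positivity
  set w := 1 - p.replaceProb * ((p.N - 1 : ℕ) : ℝ) with hw
  have hw0 : 0 < w := by
    have := hp.replaceProb_mul_lt_one (c := p.N - 1) (by have := hp.N_pos; omega)
    linarith
  -- Requests from within `r` take up half of the allowed error; the drift of the shortfall takes
  -- the other half.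
  obtain ⟨r, hr, hrR, hrε⟩ : ∃ r : ℝ, 0 < r ∧ r ≤ p.R ∧ r ^ 2 / p.R ^ 2 ≤ ε / 2 := by
    refine ⟨p.R * min 1 (ε / 2), mul_pos hR (lt_min one_pos (half_pos hε)), ?_, ?_⟩
    · exact mul_le_of_le_one_right hR.le (min_le_left _ _)
    · have h1 : min 1 (ε / 2) ≤ 1 := min_le_left _ _
      have h2 : min 1 (ε / 2) ≤ ε / 2 := min_le_right _ _
      have h3 : 0 < min 1 (ε / 2) := lt_min one_pos (half_pos hε)
      rw [mul_pow, mul_div_cancel_left₀ _ (by positivity)]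
      nlinarith
  have hEr := (hp.Eu_pos hr.le).2 hr
  -- The first term converts lost energy into blocking probability by Markov's inequality. The
  -- second makes a surplus of `δ` pay for the defect `K` and for the growth `K / w` of the deficit
  -- term during starvation.
  set K₃ := 1 / p.Eu r + (K + K / w) / δ with hK₃
  have hK₃0 : 0 < K₃ := by positivity
  obtain ⟨T, hT, hTτ⟩ := exists_le_integral_min hνi (τ := ε / (8 * K₃)) (by positivity)
  set L := p.Ep + p.Eu d with hL
  set M := (T + L + 2 * G) ^ 2 / 2 with hM
  -- With `b = Y + L + G` the depth is at least `Y` for energies up to `L` and never above `Y + L +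
  -- 2 * G ≤ 2 * Y`. The last summand makes the second-order term negligible.
  set Y := 1 + L + 2 * G + 4 * K₃ * M / ε with hY
  have hL0 : 0 < L := by positivity
  have hM0 : 0 ≤ M := by positivity
  have hYM : 0 ≤ 4 * K₃ * M / ε := by positivity
  have hY0 : 0 < Y := by positivity
  have hMY : 4 * K₃ * M / ε ≤ Y := by linarith
  set b := Y + L + G with hb
  have hb0 : 0 ≤ b := by positivity
  set Ψ : ℝ × ℕ → ℝ := fun x => K / p.replaceProb * p.excess x.2 + K / w * p.deficit x.2
    + K₃ / Y * p.shortfall d b x with hΨ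
  refine ⟨b + G, by positivity, Ψ, ?_, ⟨K / p.replaceProb * p.N + K / w * p.N
    + K₃ / Y * ((b + G) ^ 2 / 2), fun x => ?_⟩, fun B hB x hx hN => ?_⟩
  · exact ((((measurable_from_nat (f := p.excess)).comp measurable_snd).const_mul _).add
      (((measurable_from_nat (f := p.deficit)).comp measurable_snd).const_mul _)).add
      (measurable_shortfall.const_mul _)
  · refine (abs_add_three _ _ _).trans ?_
    rw [abs_mul, abs_mul, abs_mul, abs_of_pos (div_pos hK0 hq), abs_of_pos (div_pos hK0 hw0),
      abs_of_pos (div_pos hK₃0 hY0), abs_of_nonneg (shortfall_nonneg x)]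
    have h1 := abs_excess_le (p := p) x.2
    have h2 := abs_deficit_le (p := p) x.2
    have h3 := hp.shortfall_le hd hb0 x
    gcongr
  have hi1 := (hp.integrable_step_snd (ν := ν) (abs_excess_le (p := p)) B d x).const_mul
    (K / p.replaceProb)
  have hi2 := (hp.integrable_step_snd (ν := ν) (abs_deficit_le (p := p)) B d x).const_mul (K / w)
  have hi3 := (hp.integrable_shortfall_step (ν := ν) hd hb0 B x).const_mul (K₃ / Y)
  have hsplit : ∫ s, Ψ (p.step B d x s) ∂p.slotLaw ν - Ψ x
      = K / p.replaceProb * (p.pushedMean p.excess x - p.excess x.2)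
      + K / w * (p.pushedMean p.deficit x - p.deficit x.2)
      + K₃ / Y * (∫ s, p.shortfall d b (p.step B d x s) ∂p.slotLaw ν - p.shortfall d b x) := by
    simp only [hΨ]
    rw [integral_add (f := fun s => K / p.replaceProb * p.excess (p.step B d x s).2
      + K / w * p.deficit (p.step B d x s).2) (hi1.add hi2) hi3, integral_add hi1 hi2,
      integral_const_mul,
      integral_const_mul, integral_const_mul, hp.integral_step_snd B d _ hN,
      hp.integral_step_snd B d _ hN]
    ring
  clear_value K w K₃ M Y b Ψ
  set e := p.surplus ν d x with he
  set y := max (b - (x.1 + p.contentValue d x.2)) 0 with hy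
  have hg := abs_le.1 (hp.abs_contentValue_le hd x.2)
  have hy0 : 0 ≤ y := le_max_right _ _
  have hyb : y ≤ 2 * Y := max_le (by linarith) (by linarith)
  have hyY : x.1 ≤ L → Y ≤ y := fun h => le_max_of_le_left (by linarith)
  have hres : K₃ / Y * (∫ s, p.shortfall d b (p.step B d x s) ∂p.slotLaw ν - p.shortfall d b x)
      ≤ ε / 2 - K₃ / Y * (y * e) := by
    have h1 := hp.integral_shortfall_step_le (ν := ν) hν hd hb0 hT hB hx hN
    rw [← hL, ← hM, ← he, ← hy] at h1
    exact scaled_drift_le (a := ∫ a, min a T ∂ν - p.demand d) hK₃0 hY0 hε hy0 hyb (by linarith only [hTτ, hdem]) hMY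
      (by linarith only [h1])
  have hres0 : 0 ≤ e → K₃ / Y * (y * e) ≥ 0 := fun h => by positivity
  have hresY : x.1 ≤ L → 0 ≤ e → K₃ * e ≤ K₃ / Y * (y * e) := fun h h0 =>
    mul_le_div_mul_mul hK₃0.le hY0 (hyY h) h0
  have hdef := hp.abs_blockDefect_le (ν := ν) (d := d) hN
  rw [hsplit]
  rcases lt_trichotomy x.2 p.Cthr with hc | hc | hc
  · rw [excess_drift_of_le hc.le, mul_zero, zero_add]
    rcases lt_or_ge x.1 p.Ep with hE | hE
    · have h1 := hgap x.2 hc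
      rw [← surplus_of_starved (ν := ν) hc hE] at h1
      have h2 := hresY (by linarith) (by linarith)
      have h3 := mul_le_mul_of_nonneg_left (hp.deficit_drift_of_starved hc hE)
        (div_pos hK0 hw0).le
      have h4 : K + K / w ≤ K₃ * e := by
        have h5 : (K + K / w) / δ ≤ K₃ := by
          have : 0 < 1 / p.Eu r := by positivity
          linarith
        rw [div_le_iff₀ hδ] at h5
        exact h5.trans (mul_le_mul_of_nonneg_left h1 hK₃0.le)
      linarith
    · have h1 := hres0 (hp.surplus_nonneg_of_push hc hE)
      rcases Nat.lt_or_ge (x.2 + 1) p.Cthr with hc' | hc'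
      · have h2 := mul_le_mul_of_nonneg_left (hp.deficit_drift_of_push_lt hc' hE)
          (div_pos hK0 hw0).le
        have h3 : K / w * -w = -K := by field_simp
        rw [← hw, h3] at h2
        linarith
      · have hc'' : x.2 + 1 = p.Cthr := by omega
        rw [deficit_drift_of_push_eq hc'' hE, hp.blockDefect_of_push hc'' hE, abs_zero]
        linarith
  · rw [excess_drift_of_le hc.le, deficit_drift_of_ge hc.ge, mul_zero, mul_zero, zero_add, zero_add]
    have h1 := hp.abs_blockDefect_of_eq (ν := ν) hd hdR hr hrR hc
    have h2 : e = p.lostEnergy ν d x.1 := hp.surplus_of_eq hd hdR hc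
    have h3 : 0 ≤ e := h2 ▸ hp.lostEnergy_nonneg ν d x.1
    -- At high energy no depth is available, but none is needed: a store above `Eu d` loses no
    -- unicast.
    have h4 : K₃ * e ≤ K₃ / Y * (y * e) := by
      rcases le_total x.1 L with h | h
      · exact hresY h h3
      · rw [h2, lostEnergy_eq_zero (by linarith)]
        simp
    rw [← h2] at h1
    have h5 : e / p.Eu r ≤ K₃ * e := by
      have : 0 ≤ (K + K / w) / δ := by positivity
      rw [div_eq_mul_one_div, mul_comm]
      exact mul_le_mul_of_nonneg_right (by linarith) h3
    linarith
  · rw [deficit_drift_of_ge hc.le, mul_zero, add_zero]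
    have h1 := hres0 (hp.surplus_nonneg_of_gt hd hdem0 hN hc)
    have h2 := mul_le_mul_of_nonneg_left (hp.excess_drift_of_gt hc hN) (div_pos hK0 hq).le
    have h3 : K / p.replaceProb * -p.replaceProb = -K := by field_simp
    rw [h3] at h2
    linarith

end Model

/-! ### From pathwise bounds to the blocking ratio -/

/-- If bounded random variables are eventually close to `c`, so are their means. -/
theorem eventually_abs_integral_sub_lt {Ω : Type*} [MeasurableSpace Ω] {μ : Measure Ω}
    [IsProbabilityMeasure μ] {F : ℕ → Ω → ℝ} (hF : ∀ K, Measurable (F K)) {a : ℝ}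
    (ha : ∀ K ω, |F K ω| ≤ a) {c ε : ℝ} (hε : 0 < ε)
    (h : ∀ᵐ ω ∂μ, ∀ᶠ K in atTop, |F K ω - c| < ε / 2) :
    ∀ᶠ K in atTop, |∫ ω, F K ω ∂μ - c| < ε := by
  have hm : ∀ K, Measurable fun ω => max (|F K ω - c| - ε / 2) 0 := fun K =>
    ((((hF K).sub measurable_const).abs).sub measurable_const).max measurable_const
  have hb : ∀ K ω, |F K ω - c| ≤ a + |c| := fun K ω =>
    (abs_sub _ _).trans (add_le_add_left (ha K ω) _)
  have hmb : ∀ K ω, ‖max (|F K ω - c| - ε / 2) 0‖ ≤ a + |c| := fun K ω => by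
    rw [Real.norm_eq_abs, abs_of_nonneg (le_max_right _ _)]
    have := hb K ω
    exact max_le (by linarith) ((abs_nonneg _).trans this)
  -- The part of the deviation above `ε / 2` is bounded and almost surely eventually zero, so its
  -- mean vanishes by dominated convergence.
  have ht : Tendsto (fun K => ∫ ω, max (|F K ω - c| - ε / 2) 0 ∂μ) atTop (𝓝 (∫ _, (0 : ℝ) ∂μ)) := by
    refine tendsto_integral_of_dominated_convergence (fun _ => a + |c|)
      (fun K => (hm K).aestronglyMeasurable) (integrable_const _)
      (fun K => ae_of_all _ (hmb K)) ?_
    filter_upwards [h] with ω hω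
    refine tendsto_const_nhds.congr' ?_
    filter_upwards [hω] with K hK
    rw [max_eq_right (by linarith)]
  rw [integral_zero] at ht
  filter_upwards [ht.eventually_lt_const (half_pos hε)] with K hK
  have hFi : Integrable (F K) μ := Integrable.of_bound (hF K).aestronglyMeasurable a
    (ae_of_all _ fun ω => by simpa using ha K ω)
  have hMi : Integrable (fun ω => max (|F K ω - c| - ε / 2) 0) μ :=
    Integrable.of_bound (hm K).aestronglyMeasurable _ (ae_of_all _ (hmb K))
  calc |∫ ω, F K ω ∂μ - c| = |∫ ω, (F K ω - c) ∂μ| := by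
        rw [integral_sub hFi (integrable_const _)]
        simp
    _ ≤ ∫ ω, |F K ω - c| ∂μ := abs_integral_le_integral_abs
    _ ≤ ∫ ω, (max (|F K ω - c| - ε / 2) 0 + ε / 2) ∂μ := by
        refine integral_mono (hFi.sub (integrable_const _)).abs
          (hMi.add (integrable_const _)) fun ω => ?_
        have := le_max_left (|F K ω - c| - ε / 2) 0
        simp only
        linarith
    _ = ∫ ω, max (|F K ω - c| - ε / 2) 0 ∂μ + ε / 2 := by
        rw [integral_add hMi (integrable_const _)]
        simp
    _ < ε := by linarith

namespace Model

variable {p : Model} {ν : Measure ℝ} {d : ℝ} {B : EReal}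

theorem blockedRatio_eq (B : EReal) (d : ℝ) (x₀ : ℝ × ℕ) (S : ℕ → Slot) (K : ℕ) :
    p.blockedRatio B d x₀ S K = (∑ k ∈ Finset.range K,
      {z : (ℝ × ℕ) × Slot | p.Blocked d z.1 z.2}.indicator (fun _ => (1 : ℝ))
        (p.traj B d x₀ S k, S k)) / K := by
  classical
  rw [blockedRatio, Finset.card_filter]
  push_cast
  simp only [Set.indicator, Set.mem_ofPred_eq]

theorem abs_blockedRatio_le (B : EReal) (d : ℝ) (x₀ : ℝ × ℕ) (S : ℕ → Slot) (K : ℕ) :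
    |p.blockedRatio B d x₀ S K| ≤ 1 := by
  classical
  rw [blockedRatio, abs_of_nonneg (by positivity)]
  refine div_le_one_of_le₀ ?_ (Nat.cast_nonneg _)
  have := Finset.card_filter_le (Finset.range K) fun k => p.Blocked d (p.traj B d x₀ S k) (S k)
  rw [Finset.card_range] at this
  exact_mod_cast this

variable {Ω : Type*} [MeasurableSpace Ω] {S : ℕ → Ω → Slot}

theorem Valid.measurable_traj (hp : p.Valid) (hS : ∀ k, Measurable (S k)) (B : EReal) (d : ℝ)
    (x₀ : ℝ × ℕ) (k : ℕ) : Measurable fun ω => p.traj B d x₀ (fun k => S k ω) k := by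
  induction k with
  | zero => exact measurable_const
  | succ k ih =>
    have h : Measurable fun ω => Function.uncurry (p.step B d)
        (p.traj B d x₀ (fun k => S k ω) k, S k ω) := (hp.measurable_step B d).comp (ih.prodMk (hS k))
    simpa only [traj, Function.uncurry] using h

theorem Valid.measurable_blockedRatio (hp : p.Valid) (hS : ∀ k, Measurable (S k)) (B : EReal)
    (d : ℝ) (x₀ : ℝ × ℕ) (K : ℕ) :
    Measurable fun ω => p.blockedRatio B d x₀ (fun k => S k ω) K := by
  simp_rw [blockedRatio_eq]
  refine (Finset.measurable_sum _ fun k _ => ?_).div_const _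
  exact (measurable_const.indicator (hp.measurableSet_blocked d)).comp
    ((hp.measurable_traj hS B d x₀ k).prodMk (hS k))

theorem traj_mem (hB : 0 ≤ B) (d : ℝ) {x₀ : ℝ × ℕ} (h0 : 0 ≤ x₀.1) (hN : x₀.2 ≤ p.N)
    {s : ℕ → Slot} (hs : ∀ k, 0 ≤ (s k).harvest) (k : ℕ) :
    0 ≤ (p.traj B d x₀ s k).1 ∧ (p.traj B d x₀ s k).2 ≤ p.N := by
  induction k with
  | zero => exact ⟨h0, hN⟩
  | succ k ih =>
    refine ⟨?_, step_snd_le B d ih.2 (s k)⟩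
    have h1 := energyUsed_le_energy (p := p) d ih.1 (s k)
    refine EReal.toReal_nonneg (le_min hB ?_)
    exact_mod_cast (by linarith [hs k] : (0 : ℝ) ≤ _)

variable {μ : Measure Ω} [IsProbabilityMeasure μ]

theorem Valid.eventually_abs_blockedRatio_sub_lt (hp : p.Valid) [IsProbabilityMeasure ν]
    (hν : ∀ᵐ a ∂ν, 0 ≤ a) (hνi : Integrable (fun a : ℝ => a) ν) (hd : 0 ≤ d) (hdR : d ≤ p.R)
    (hdem0 : 0 ≤ p.demand d) (hdem : p.demand d ≤ ∫ a, a ∂ν)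
    (hS : ∀ k, Measurable (S k)) (hlaw : ∀ k, μ.map (S k) = p.slotLaw ν) (hind : iIndepFun S μ)
    {ε : ℝ} (hε : 0 < ε) :
    ∃ B₀ : ℝ, ∀ B : EReal, (B₀ : EReal) ≤ B → ∀ x₀ : ℝ × ℕ, 0 ≤ x₀.1 → x₀.2 ≤ p.N →
      ∀ᵐ ω ∂μ, ∀ᶠ K in atTop,
        |p.blockedRatio B d x₀ (fun k => S k ω) K - p.pblkRadius d| < ε := by
  have := hp.isProbabilityMeasure_slotLaw ν
  obtain ⟨B₀, hB₀, Ψ, hΨ, ⟨a, ha⟩, hdrift⟩ :=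
    hp.exists_test_function hν hνi hd hdR hdem0 hdem (half_pos hε)
  refine ⟨B₀, fun B hB x₀ h0 hN => ?_⟩
  have hB0 : 0 ≤ B := le_trans (by exact_mod_cast hB₀) hB
  have hA : ∀ᵐ ω ∂μ, ∀ k, p.traj B d x₀ (fun k => S k ω) k ∈ {x : ℝ × ℕ | 0 ≤ x.1 ∧ x.2 ≤ p.N} := by
    have hh : ∀ᵐ ω ∂μ, ∀ k, 0 ≤ (S k ω).harvest := by
      refine ae_all_iff.2 fun k => ?_
      have := ae_slotLaw_harvest_nonneg hp hν
      rw [← hlaw k] at this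
      exact ae_of_ae_map (hS k).aemeasurable this
    filter_upwards [hh] with ω hω k
    exact traj_mem hB0 d h0 hN hω k
  -- The sign `σ` flips blocking and `blockValue`, but not `Ψ`: since `Ψ` dominates the absolute
  -- defect, the same test function serves the upper and the lower bound.
  have hside : ∀ σ : ℝ, |σ| = 1 → ∀ᵐ ω ∂μ, ∀ᶠ K : ℕ in atTop,
      σ * (p.blockedRatio B d x₀ (fun k => S k ω) K - p.pblkRadius d) < ε := by
    intro σ hσ
    have hm1 : Measurable fun z : (ℝ × ℕ) × Slot =>
        {z : (ℝ × ℕ) × Slot | p.Blocked d z.1 z.2}.indicator (fun _ => (1 : ℝ)) z :=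
      measurable_const.indicator (hp.measurableSet_blocked d)
    have hi0 : ∀ z, |{z : (ℝ × ℕ) × Slot | p.Blocked d z.1 z.2}.indicator (fun _ => (1 : ℝ)) z|
        ≤ 1 := by
      intro z
      by_cases hz : z ∈ {z : (ℝ × ℕ) × Slot | p.Blocked d z.1 z.2} <;> simp [hz]
    have hbv : Measurable fun x : ℝ × ℕ => p.blockValue d x.2 :=
      (measurable_from_nat (f := p.blockValue d)).comp measurable_snd
    have hev := eventually_avg_le_of_drift (μ := μ) (ρ := p.slotLaw ν) hS hlaw hind
      (hp.measurable_step B d) x₀ (Z := fun k ω => p.traj B d x₀ (fun k => S k ω) k)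
      (fun _ => rfl) (fun _ _ => rfl)
      (r := fun x s => σ * ({z : (ℝ × ℕ) × Slot | p.Blocked d z.1 z.2}.indicator
        (fun _ => (1 : ℝ)) (x, s) - p.pblkRadius d))
      ((hm1.sub measurable_const).const_mul σ) (a := 1 + |p.pblkRadius d|)
      (fun x s => by
        rw [abs_mul, hσ, one_mul]
        exact (abs_sub _ _).trans (add_le_add_left (hi0 _) _))
      (Φ := fun x => σ * p.blockValue d x.2 + Ψ x) ((hbv.const_mul σ).add hΨ)
      (a' := |p.blockGain d| + a)
      (fun x => by
        refine (abs_add_le _ _).trans (add_le_add ?_ (ha x))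
        rw [abs_mul, hσ, one_mul]
        exact abs_blockValue_le d x.2)
      hA (c := ε / 2) ?_ (δ := ε / 4) (by positivity)
    · filter_upwards [hev] with ω hω
      filter_upwards [hω, eventually_ge_atTop 1] with K hK hK1
      have hK0 : (K : ℝ) ≠ 0 := by exact_mod_cast (by omega : K ≠ 0)
      rw [← Finset.mul_sum, Finset.sum_sub_distrib, mul_div_assoc, sub_div, ← blockedRatio_eq,
        Finset.sum_const, Finset.card_range, nsmul_eq_mul, mul_div_cancel_left₀ _ hK0] at hK
      linarith
    · rintro x ⟨hx0, hxN⟩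
      have hd1 := hdrift B hB x hx0 hxN
      have hi1 : Integrable (fun s => {z : (ℝ × ℕ) × Slot | p.Blocked d z.1 z.2}.indicator
          (fun _ => (1 : ℝ)) (x, s)) (p.slotLaw ν) :=
        Integrable.of_bound (measurable_slot_of_pair hm1 x).aestronglyMeasurable 1
          (ae_of_all _ fun s => hi0 _)
      have hi2 := hp.integrable_step_snd (ν := ν) (p.abs_blockValue_le d) B d x
      have hi3 : Integrable (fun s => Ψ (p.step B d x s)) (p.slotLaw ν) :=
        Integrable.of_bound (hΨ.comp (measurable_slot_of_pair
          (hp.measurable_step B d) x)).aestronglyMeasurable a (ae_of_all _ fun s => ha _)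
      have hi4 := (hi1.sub (integrable_const (p.pblkRadius d))).const_mul σ
      have hbp : ∫ s, {z : (ℝ × ℕ) × Slot | p.Blocked d z.1 z.2}.indicator
          (fun _ => (1 : ℝ)) (x, s) ∂p.slotLaw ν = p.blockProb ν d x := by
        rw [hp.blockProb_eq_integral]
        rfl
      have hsum : ∫ s, (σ * ({z : (ℝ × ℕ) × Slot | p.Blocked d z.1 z.2}.indicator
          (fun _ => (1 : ℝ)) (x, s) - p.pblkRadius d)
          + (σ * p.blockValue d (p.step B d x s).2 + Ψ (p.step B d x s))) ∂p.slotLaw ν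
          = σ * (p.blockProb ν d x - p.pblkRadius d)
          + (σ * p.pushedMean (p.blockValue d) x + ∫ s, Ψ (p.step B d x s) ∂p.slotLaw ν) := by
        rw [integral_add (f := fun s => σ * ({z : (ℝ × ℕ) × Slot |
          p.Blocked d z.1 z.2}.indicator (fun _ => (1 : ℝ)) (x, s) - p.pblkRadius d))
          (g := fun s => σ * p.blockValue d (p.step B d x s).2 + Ψ (p.step B d x s)) hi4
          ((hi2.const_mul σ).add hi3), integral_add (hi2.const_mul σ) hi3, integral_const_mul,
          integral_const_mul, hp.integral_step_snd B d _ hxN, integral_sub hi1 (integrable_const _),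
          hbp]
        simp
      rw [hsum]
      have hσd : σ * p.blockDefect ν d x ≤ |p.blockDefect ν d x| := by
        calc σ * p.blockDefect ν d x ≤ |σ * p.blockDefect ν d x| := le_abs_self _
          _ = |p.blockDefect ν d x| := by rw [abs_mul, hσ, one_mul]
      rw [blockDefect] at hσd hd1
      linarith
  filter_upwards [hside 1 (by simp), hside (-1) (by simp)] with ω h1 h2
  filter_upwards [h1, h2] with K hK1 hK2
  rw [abs_lt]
  constructor <;> linarith

end Model

end PushEH

/-! ### The main theorem -/

theorem theorem2 (p : PushEH.Model) (hp : p.Valid)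
    {Ω : Type*} [MeasurableSpace Ω] (μ : Measure Ω) [IsProbabilityMeasure μ]
    (ν : Measure ℝ) [IsProbabilityMeasure ν] (hν_nonneg : ∀ᵐ a ∂ν, 0 ≤ a)
    (hν_int : Integrable (fun a : ℝ => a) ν)
    (Abar : ℝ) (hAbar : ∫ a, a ∂ν = Abar)
    (S : ℕ → Ω → PushEH.Slot) (hS_meas : ∀ k, Measurable (S k))
    (hS_law : ∀ k, μ.map (S k) = p.slotLaw ν) (hS_indep : iIndepFun S μ)
    (hA : p.pc * p.Cthr * p.Ep / (p.N + p.pc) ≤ Abar) :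
    -- the unicast radius is indeed the largest admissible one
    IsGreatest (p.admissibleRadii Abar) (p.dTilde Abar) ∧
    -- infinite battery
    (∀ (E₀ : ℝ) (C₀ : ℕ), 0 ≤ E₀ → C₀ ≤ p.N →
      (∀ᵐ ω ∂μ, Tendsto
        (fun K => p.blockedRatio ⊤ (p.dTilde Abar) (E₀, C₀) (fun k => S k ω) K)
        atTop (𝓝 (p.pblkEE Abar))) ∧
      Tendsto
        (fun K => ∫ ω, p.blockedRatio ⊤ (p.dTilde Abar) (E₀, C₀) (fun k => S k ω) K ∂μ)
        atTop (𝓝 (p.pblkEE Abar))) ∧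
    -- finite battery of capacity `B → ∞`
    (∀ ε : ℝ, 0 < ε → ∃ B₀ : ℝ, ∀ B : ℝ, B₀ ≤ B →
      ∀ (E₀ : ℝ) (C₀ : ℕ), 0 ≤ E₀ → E₀ ≤ B → C₀ ≤ p.N →
      (∀ᵐ ω ∂μ, ∀ᶠ K in atTop,
        |p.blockedRatio B (p.dTilde Abar) (E₀, C₀) (fun k => S k ω) K - p.pblkEE Abar| < ε) ∧
      ∀ᶠ K in atTop,
        |(∫ ω, p.blockedRatio B (p.dTilde Abar) (E₀, C₀) (fun k => S k ω) K ∂μ)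
          - p.pblkEE Abar| < ε) := by
  have hgr := hp.isGreatest_dTilde Abar
  obtain ⟨hd, hdR, -, hη⟩ := hgr.1
  -- The assumption on the mean harvest removes the outer `max` with zero, so admissibility of the
  -- radius says that demand does not exceed harvest; equality is allowed.
  have hA' : p.pushPower ≤ Abar := hA
  have hdem : p.demand (p.dTilde Abar) ≤ ∫ a, a ∂ν := by
    rw [max_eq_right (by linarith)] at hη
    rw [hp.demand_eq_pushPower_add, hAbar]
    linarith
  have hdem0 : 0 ≤ p.demand (p.dTilde Abar) := by
    have h1 := hp.N_pos'
    have h2 := hp.pc_pos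
    have h3 := hp.Ep_pos
    have h4 : p.pc * p.Cthr / (p.N + p.pc) ≤ 1 := by
      have hC : (p.Cthr : ℝ) ≤ p.N := by exact_mod_cast p.Cthr_le_N
      rw [div_le_one (by positivity)]
      nlinarith [hp.pc_le_one]
    have h5 : 0 ≤ p.η := mul_nonneg (mul_nonneg (by linarith) hp.pu_nonneg)
      (hp.tail_nonneg p.Cthr_le_N)
    have h6 : 0 ≤ p.pushPower := by
      unfold PushEH.Model.pushPower
      positivity
    rw [hp.demand_eq_pushPower_add]
    exact add_nonneg h6 (mul_nonneg h5 (hp.unicastEnergy_nonneg hd))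
  have key : ∀ ε : ℝ, 0 < ε → _ := fun ε hε => hp.eventually_abs_blockedRatio_sub_lt hν_nonneg
    hν_int hd hdR hdem0 hdem hS_meas hS_law hS_indep hε
  refine ⟨hgr, fun E₀ C₀ hE₀ hC₀ => ?_, fun ε hε => ?_⟩
  · have has : ∀ᵐ ω ∂μ, Tendsto
        (fun K => p.blockedRatio ⊤ (p.dTilde Abar) (E₀, C₀) (fun k => S k ω) K)
        atTop (𝓝 (p.pblkEE Abar)) := by
      -- An infinite battery exceeds the required capacity for every tolerance; countably many
      -- tolerances share one null set.
      have hall : ∀ᵐ ω ∂μ, ∀ n : ℕ, ∀ᶠ K in atTop,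
          |p.blockedRatio ⊤ (p.dTilde Abar) (E₀, C₀) (fun k => S k ω) K
            - p.pblkRadius (p.dTilde Abar)| < 1 / ((n : ℝ) + 1) := by
        refine ae_all_iff.2 fun n => ?_
        obtain ⟨B₀, h⟩ := key (1 / ((n : ℝ) + 1)) (by positivity)
        exact h ⊤ le_top (E₀, C₀) hE₀ hC₀
      filter_upwards [hall] with ω hω
      refine Metric.tendsto_nhds.2 fun ε hε => ?_
      obtain ⟨n, hn⟩ := exists_nat_one_div_lt hε
      filter_upwards [hω n] with K hK
      exact hK.trans hn
    refine ⟨has, ?_⟩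
    have := tendsto_integral_of_dominated_convergence (fun _ => (1 : ℝ))
      (fun K => (hp.measurable_blockedRatio hS_meas ⊤ (p.dTilde Abar) (E₀, C₀)
        K).aestronglyMeasurable) (integrable_const _)
      (fun K => ae_of_all μ fun ω => PushEH.Model.abs_blockedRatio_le _ _ _ _ _) has
    simpa using this
  · obtain ⟨B₀, h⟩ := key (ε / 2) (half_pos hε)
    refine ⟨B₀, fun B hB E₀ C₀ hE₀ _ hC₀ => ?_⟩
    have h1 := h B (by exact_mod_cast hB) (E₀, C₀) hE₀ hC₀
    refine ⟨?_, PushEH.eventually_abs_integral_sub_lt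
      (fun K => hp.measurable_blockedRatio hS_meas B (p.dTilde Abar) (E₀, C₀) K)
      (fun K ω => PushEH.Model.abs_blockedRatio_le _ _ _ _ _) hε h1⟩
    filter_upwards [h1] with ω hω
    filter_upwards [hω] with K hK
    exact lt_trans hK (half_lt_self hε)
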